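/- **Setting.** Fix real numbers $0<\beta<\alpha<\gamma$ and $s,N,\bar\delta>0$, and $\bar p\in\mathbb R$. A mass $N$ of commuters enters a bottleneck of capacity $s$ during $[0,N/s]$ at a rate $r\ge 0$, $\int_0^{N/s}r=N$. The queue is $Q(t)=\max_{0\le u\le t}\big(\int_u^t r(\tau)\,d\tau-s(t-u)\big)$ and the waiting time is $T^{v}(t)=Q(t)/s$. The common desired arrival time is $t^*=\gamma N/(s(\beta+\gamma))$ (time $0$ is the start of the rush hour without incentives). A discount is a measurable function $p\ge 0$ on $[0,N/s]$. A commuter who enters the bottleneck at $t\in[0,N/s]$ after charging for a time $\delta\in[0,\bar\delta]$ at a station pays $$C(t,\delta)=\alpha T^v(t)+\max\{\beta d,-\gamma d\}+\alpha\delta+(\bar\delta-\delta)\bar p+\int_{t-\delta}^t\Big(\bar p-\tfrac{p(t)}{\bar\delta}(t-\delta+\bar\delta-\tau)\Big)d\tau,\qquad d=t^*-t-T^v(t).$$ An equilibrium under $p$ is a pair $(r,\delta)$ such that, for every $t$ with $r(t)>0$, $(t,\delta(t))$ minimises $C$ over $[0,N/s]\times[0,\bar\delta]$. Its monetary budget is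 $\int_0^{N/s}r\,\delta\,p\,dt$, its perceived budget is $-\int_0^{N/s}r(t)\big(C_{ch}(t,\delta(t))-\bar\delta\bar p\big)dt$, where $C_{ch}(t,\delta)$ denotes the last three terms of $C(t,\delta)$, and its congestion is $\Gamma=\int_0^{N/s}T^v(t)\,dt$. For a budget $M_\$$, a discount with an equilibrium is *optimal* if the equilibrium has (finite) monetary budget at most $M_\$$, has the least $\Gamma$ among all equilibria under all discounts with budget at most $M_\$$, and uses the least budget among the minimisers. For $m\ge0$ let $$t^\ell_m=\sqrt{\tfrac{2\gamma m}{s\beta(\beta+\gamma)}},\qquad t^r_m=\tfrac Ns-\sqrt{\tfrac{2\beta m}{s\gamma(\beta+\gamma)}},$$ $$f(m)=m+\frac{s\bar\delta}{2}\Big[\frac{\bar\delta}{\beta}\int_\alpha^{\alpha+t_m^\ell\beta/\bar\delta}2\sqrt{y^2-\alpha^2}\,dy+\frac{\bar\delta}{\gamma}\int_\alpha^{\alpha+\frac{\gamma}{\bar\delta}(\frac Ns-t_m^r)}2\sqrt{z^2-\alpha^2}\,dz\Big].$$ Let $M_{per}^*=\frac{\beta\gamma N^2}{2s(\beta+\gamma)}$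 and $M_\$^*=M_{per}^*+s\bar\delta\int_0^{N/s}\frac{p^*(\tau)^2-\alpha^2}{2p^*(\tau)}d\tau$, where $p^*(t)=\alpha-\frac g{\bar\delta}+\sqrt{(\frac g{\bar\delta}-\alpha)^2-\alpha^2}$ with $g=\beta(t-t^*)$ for $t<t^*$ and $g=\gamma(t^*-t)$ for $t\ge t^*$. Let $t'=t^*-\frac{\beta\gamma N}{\alpha s(\beta+\gamma)}$. **Proposition (optimal discount with limited budget).** The map $f$ is a bijection from $[0,M_{per}^*]$ onto $[0,M_\$^*]$. Equilibria under the zero discount exist, and in each of them $t'$ is the only $t\in[0,N/s]$ with $t+T^v(t)=t^*$. Let $0\le M_\$\le M_\$^*$, $m=f^{-1}(M_\$)$, $t^\ell=t^\ell_m$, $t^r=t^r_m$ and $t''=t'+\frac1\alpha\sqrt{\frac{2\beta\gamma f^{-1}(M_\$)}{s(\beta+\gamma)}}$. Then the discount $$p(t)=\begin{cases}0,&t\in(t^\ell,t^r)\\ \alpha-\frac g{\bar\delta}+\sqrt{\big(\frac g{\bar\delta}-\alpha\big)^2-\alpha^2},&\text{otherwise}\end{cases}\qquad g=\begin{cases}\beta(t-t^\ell),&t\le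 t^\ell\\ \gamma(t^r-t),&t\ge t^r\end{cases}$$ on $[0,N/s]$ is optimal for the budget $M_\$$, with the equilibrium departure rate $$r(t)=\begin{cases}s,&t\in[0,t^\ell]\cup[t^r,N/s]\\ \alpha s/(\alpha-\beta),&t\in(t^\ell,t'']\\ \alpha s/(\alpha+\gamma),&t\in(t'',t^r);\end{cases}$$ its monetary budget is $M_\$$, its perceived budget is $f^{-1}(M_\$)$, and $t''$ is the only $t\in[0,N/s]$ with $t+T^v(t)=t^*$. Every equilibrium under $p$ has departure rate $r$ almost everywhere. Every optimal discount for $M_\$$ agrees with $p$ almost everywhere on $[0,N/s]$, up to replacing the value $0$ on $(t^\ell,t^r)$ by values in $[0,\alpha]$ (which have no effect), and its equilibrium departure rate is $r$ almost everywhere. -/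

import Mathlib

open Set MeasureTheory

noncomputable section

/-- Parameters of the bottleneck model with charging: unit costs of waiting (`α`), of being early
(`β`) and of being late (`γ`), bottleneck capacity `s`, mass `N` of commuters, charging time `δbar`
that every vehicle needs, and energy price `pbar` at home. -/
structure Bottleneck where
  α : ℝ
  β : ℝ
  γ : ℝ
  s : ℝ
  N : ℝ
  δbar : ℝ
  pbar : ℝ
  β_pos : 0 < β
  β_lt_α : β < α
  α_lt_γ : α < γ
  s_pos : 0 < s
  N_pos : 0 < N
  δbar_pos : 0 < δbar

namespace Bottleneck

variable (P : Bottleneck)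

/-- Length of the rush hour; commuters depart during `[0, N/s]`. -/
def horizon : ℝ := P.N / P.s

/-- Common desired arrival time. Time `0` is the start of the rush hour without incentives, which
amounts to this value (the schedule delay costs of arriving at `0` and at `N/s` are equal). -/
def tStar : ℝ := P.γ * P.N / (P.s * (P.β + P.γ))

/-! ### The queue and the costs -/

/-- Length at time `t` of the queue that starts empty at time `0`, is fed at rate `r` and is
served at capacity `s` while it is nonempty. The supremum is attained at the last time
`u ∈ [0, t]` at which the queue is empty. -/
def queue (r : ℝ → ℝ) (t : ℝ) : ℝ :=
  sSup ((fun u => (∫ τ in u..t, r τ) - P.s * (t - u)) '' Icc 0 t)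

/-- Waiting time of a commuter who enters the bottleneck at time `t`. -/
def wait (r : ℝ → ℝ) (t : ℝ) : ℝ := P.queue r t / P.s

/-- Travel cost: waiting cost plus cost of arriving early or late. -/
def travelCost (r : ℝ → ℝ) (t : ℝ) : ℝ :=
  P.α * P.wait r t +
    max (P.β * (P.tStar - t - P.wait r t)) (-P.γ * (P.tStar - t - P.wait r t))

/-- Incentive perceived at time `τ ∈ [t - δ, t]` by a commuter who charges during `[t - δ, t]`. -/
def perceivedDiscount (p : ℝ → ℝ) (t δ τ : ℝ) : ℝ :=
  -(p t / P.δbar) * τ + p t / P.δbar * (t - δ + P.δbar)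

/-- Cost of charging for `δ` at the station before entering the bottleneck at time `t`, the
remaining energy being bought at home. -/
def chargeCost (p : ℝ → ℝ) (t δ : ℝ) : ℝ :=
  P.α * δ + (P.δbar - δ) * P.pbar + ∫ τ in (t - δ)..t, (P.pbar - P.perceivedDiscount p t δ τ)

/-- Total cost of a commuter. -/
def cost (p r : ℝ → ℝ) (t δ : ℝ) : ℝ := P.travelCost r t + P.chargeCost p t δ

/-! ### Policies, equilibria, budgets, optimality -/

/-- A discount policy on `[0, N/s]`. -/
def IsDiscount (p : ℝ → ℝ) : Prop :=
  Measurable p ∧ ∀ t ∈ Icc 0 P.horizon, 0 ≤ p t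

/-- The departure rate `r` and the charging times `δ` form an equilibrium under the discount `p`:
`N` commuters depart during `[0, N/s]`, and every commuter (departing at `t`, charging for `δ t`)
minimises his cost over all departure times and all charging times. -/
structure IsEquilibrium (p r δ : ℝ → ℝ) : Prop where
  rate_nonneg : ∀ t ∈ Icc 0 P.horizon, 0 ≤ r t
  rate_integrable : IntervalIntegrable r volume 0 P.horizon
  rate_total : ∫ t in (0 : ℝ)..P.horizon, r t = P.N
  charge_mem : ∀ t ∈ Icc 0 P.horizon, 0 < r t → δ t ∈ Icc 0 P.δbar
  best_response : ∀ t ∈ Icc 0 P.horizon, 0 < r t →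
    ∀ t' ∈ Icc 0 P.horizon, ∀ δ' ∈ Icc 0 P.δbar, P.cost p r t (δ t) ≤ P.cost p r t' δ'

/-- Total system travel time (congestion). -/
def tstt (r : ℝ → ℝ) : ℝ := ∫ t in (0 : ℝ)..P.horizon, P.wait r t

/-- Monetary budget that the discount `p` uses. -/
def spent (p r δ : ℝ → ℝ) : ℝ := ∫ t in (0 : ℝ)..P.horizon, r t * δ t * p t

/-- Perceived budget. -/
def perceived (p r δ : ℝ → ℝ) : ℝ :=
  -∫ t in (0 : ℝ)..P.horizon, r t * (P.chargeCost p t (δ t) - P.δbar * P.pbar)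

/-- A discount policy with an equilibrium that uses a (finite) budget of at most `M`. -/
structure IsFeasible (M : ℝ) (p r δ : ℝ → ℝ) : Prop where
  discount : P.IsDiscount p
  equilibrium : P.IsEquilibrium p r δ
  integrable : IntervalIntegrable (fun t => r t * δ t * p t) volume 0 P.horizon
  spent_le : P.spent p r δ ≤ M

/-- The policy minimises congestion among all policies of budget at most `M`, and uses the
smallest budget among the minimisers. -/
structure IsOptimal (M : ℝ) (p r δ : ℝ → ℝ) : Prop where
  feasible : P.IsFeasible M p r δ
  tstt_le : ∀ p' r' δ' : ℝ → ℝ, P.IsFeasible M p' r' δ' → P.tstt r ≤ P.tstt r'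
  spent_le : ∀ p' r' δ' : ℝ → ℝ, P.IsFeasible M p' r' δ' → P.tstt r' = P.tstt r →
    P.spent p r δ ≤ P.spent p' r' δ'

/-! ### Closed forms (`m` stands for a perceived budget) -/

/-- Discount whose perceived value is `-g`. -/
def priceOf (g : ℝ) : ℝ :=
  P.α - g / P.δbar + √((g / P.δbar - P.α) ^ 2 - P.α ^ 2)

/-- Optimal discount with unlimited budget. -/
def unlimitedDiscount (t : ℝ) : ℝ :=
  P.priceOf (if t < P.tStar then P.β * (t - P.tStar) else P.γ * (P.tStar - t))

/-- Perceived budget that eliminates congestion. -/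
def perceivedMax : ℝ := P.β * P.γ * P.N ^ 2 / (2 * P.s * (P.β + P.γ))

/-- Monetary budget that eliminates congestion. -/
def budgetMax : ℝ :=
  P.perceivedMax + P.s * P.δbar * ∫ t in (0 : ℝ)..P.horizon,
    (P.unlimitedDiscount t ^ 2 - P.α ^ 2) / (2 * P.unlimitedDiscount t)

def tLeft (m : ℝ) : ℝ := √(2 * P.γ * m / (P.s * P.β * (P.β + P.γ)))

def tRight (m : ℝ) : ℝ := P.N / P.s - √(2 * P.β * m / (P.s * P.γ * (P.β + P.γ)))

/-- Departure time for arriving exactly at `tStar` when there is no incentive. -/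
def tPrime : ℝ := P.tStar - P.β * P.γ * P.N / (P.α * P.s * (P.β + P.γ))

def tPeak (m : ℝ) : ℝ :=
  P.tPrime + 1 / P.α * √(2 * P.β * P.γ * m / (P.s * (P.β + P.γ)))

/-- The map from perceived to monetary budgets. -/
def f (m : ℝ) : ℝ :=
  m + P.s * P.δbar / 2 *
    (P.δbar / P.β *
        (∫ y in P.α..(P.α + P.tLeft m * P.β / P.δbar), 2 * √(y ^ 2 - P.α ^ 2)) +
      P.δbar / P.γ *
        (∫ z in P.α..(P.α + P.γ / P.δbar * (P.N / P.s - P.tRight m)),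
          2 * √(z ^ 2 - P.α ^ 2)))

/-- Inverse of `f` on the perceived budgets in `[0, perceivedMax]`. -/
def fInv (M : ℝ) : ℝ := Function.invFunOn P.f (Icc 0 P.perceivedMax) M

open Classical in
/-- Optimal discount with limited budget. -/
def limitedDiscount (m t : ℝ) : ℝ :=
  if t ∈ Ioo (P.tLeft m) (P.tRight m) then 0
  else P.priceOf (if t ≤ P.tLeft m then P.β * (t - P.tLeft m) else P.γ * (P.tRight m - t))

open Classical in
/-- Departure rate with limited budget. -/
def limitedRate (m t : ℝ) : ℝ :=
  if t ∈ Ioc (P.tLeft m) (P.tPeak m) then P.α * P.s / (P.α - P.β)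
  else if t ∈ Ioo (P.tPeak m) (P.tRight m) then P.α * P.s / (P.α + P.γ)
  else P.s

end Bottleneck

end

/-!
A discount matters only through the gain `saving (p t)` that commuters perceive when they charge
optimally. A perceived gain `v` costs the authority `outlay v`, a strictly increasing function
of `v`. Hence an equilibrium has a cost `c` such that the travel cost equals `c + saving (p t)` at
every time of departure, and is at least `c` at all times.

The cost `c` bounds both congestion and budget. Since the travel cost is at least `c`, the waiting
time is at least `waitAt c`, which increases with `c`. On the other hand, a commuter who arrives at
time `y` has travel cost at least `sched y`, so that he costs the authority at least
`outlay (max (sched y - c) 0)`. At most `s` commuters arrive per unit of time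
(`IsRate.lintegral_arrival_le`), and `[0, N/s]` is a sublevel set of `sched` of the length that `N`
commuters need, so the total is at least `budgetAt c`, the value for arrivals at rate `s` during
`[0, N/s]` (`IsRate.budgetAt_le`). As `budgetAt` is strictly decreasing below `maxCost` and
`f m = budgetAt (level m)` (`f_eq`), the budget `f m` forces `level m ≤ c`, so that the waiting time
is at least `waitAt (level m)` (`IsFeasible.exists_cost`). The closed form attains these bounds.

Uniqueness follows from the case of equality. Minimal congestion forces the waiting time to be
`waitAt (level m)`, and the cost to be `level m`. The waiting time determines the rate
(`IsRate.ae_eq_limitedRate`): the mass that departs in an interval is at most `s` times the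
increment of the arrival time, and the totals over `[0, N/s]` agree. The equilibrium condition then
determines the perceived gain, hence the discount where the gain is positive. For a given discount
worth `max (sched t - level m) 0`, the equilibrium cost must be `level m`: it is not larger because nobody
waits at time `0`, and not smaller because all commuters would arrive in too short an interval
(`IsEquilibrium.wait_eq`).
-/

noncomputable section

namespace Bottleneck

variable (P : Bottleneck)

lemma α_pos : 0 < P.α := P.β_pos.trans P.β_lt_α

lemma γ_pos : 0 < P.γ := P.α_pos.trans P.α_lt_γ

lemma horizon_pos : 0 < P.horizon := div_pos P.N_pos P.s_pos

lemma s_mul_horizon : P.s * P.horizon = P.N := mul_div_cancel₀ _ P.s_pos.ne'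

/-! ### The charging decision -/

/-- What a commuter perceives to gain from the discount `q` when he charges optimally; the
value `0` for `q = 0` is the right one. -/
def saving (q : ℝ) : ℝ := P.δbar * max (q - P.α) 0 ^ 2 / (2 * q)

/-- The optimal charging time under the discount `q`; the value `0` for `q = 0` is the right one. -/
def chargeTime (q : ℝ) : ℝ := P.δbar * max (q - P.α) 0 / q

/-- The payment by which the authority makes a commuter perceive the gain `v`. -/
def outlay (v : ℝ) : ℝ := v + √(v ^ 2 + 2 * P.α * P.δbar * v)

lemma chargeCost_eq (p : ℝ → ℝ) (t δ : ℝ) :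
    P.chargeCost p t δ =
      P.δbar * P.pbar - ((p t - P.α) * δ - p t * δ ^ 2 / (2 * P.δbar)) := by
  have hD := P.δbar_pos.ne'
  have h : ∀ τ ∈ uIcc (t - δ) t, HasDerivAt
      (fun τ => P.pbar * τ + p t / P.δbar * τ ^ 2 / 2 - p t / P.δbar * (t - δ + P.δbar) * τ)
      (P.pbar - P.perceivedDiscount p t δ τ) τ := by
    intro τ _
    have := (((hasDerivAt_id τ).const_mul P.pbar).add
      ((((hasDerivAt_id τ).pow 2).const_mul (p t / P.δbar)).div_const 2)).sub
      ((hasDerivAt_id τ).const_mul (p t / P.δbar * (t - δ + P.δbar)))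
    refine this.congr_deriv ?_
    simp [perceivedDiscount]
    ring
  rw [chargeCost, intervalIntegral.integral_eq_sub_of_hasDerivAt h]
  · field_simp
    ring
  · apply Continuous.intervalIntegrable
    unfold perceivedDiscount
    fun_prop

lemma saving_nonneg {q : ℝ} (hq : 0 ≤ q) : 0 ≤ P.saving q := by
  have := P.δbar_pos
  unfold saving
  positivity

lemma saving_of_le {q : ℝ} (hq : q ≤ P.α) : P.saving q = 0 := by
  simp [saving, max_eq_right (sub_nonpos.2 hq)]

lemma chargeTime_of_le {q : ℝ} (hq : q ≤ P.α) : P.chargeTime q = 0 := by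
  simp [chargeTime, max_eq_right (sub_nonpos.2 hq)]

/-- Completing the square in the charging cost. -/
lemma saving_sub_gain {q : ℝ} (hq : P.α < q) (δ : ℝ) :
    P.saving q - ((q - P.α) * δ - q * δ ^ 2 / (2 * P.δbar)) =
      q / (2 * P.δbar) * (δ - P.chargeTime q) ^ 2 := by
  have hD := P.δbar_pos.ne'
  have hq' : q ≠ 0 := (P.α_pos.trans hq).ne'
  rw [saving, chargeTime, max_eq_left (sub_nonneg.2 hq.le)]
  field_simp
  ring

lemma chargeTime_mem {q : ℝ} (hq : 0 ≤ q) : P.chargeTime q ∈ Icc 0 P.δbar := by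
  have hD := P.δbar_pos
  have hα := P.α_pos
  refine ⟨by unfold chargeTime; positivity, ?_⟩
  rcases le_or_gt q P.α with h | h
  · rw [P.chargeTime_of_le h]; exact hD.le
  · rw [chargeTime, max_eq_left (sub_nonneg.2 h.le), div_le_iff₀ (hα.trans h)]
    nlinarith

lemma chargeCost_ge {p : ℝ → ℝ} {t δ : ℝ} (hp : 0 ≤ p t) (hδ : 0 ≤ δ) :
    P.δbar * P.pbar - P.saving (p t) ≤ P.chargeCost p t δ := by
  have hD := P.δbar_pos
  rw [chargeCost_eq]
  rcases le_or_gt (p t) P.α with h | h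
  · rw [P.saving_of_le h]
    have : 0 ≤ p t * δ ^ 2 / (2 * P.δbar) := by positivity
    nlinarith [mul_nonneg (sub_nonneg.2 h) hδ]
  · have h1 := P.saving_sub_gain h δ
    have : 0 ≤ p t / (2 * P.δbar) * (δ - P.chargeTime (p t)) ^ 2 := by positivity
    linarith

lemma chargeCost_chargeTime (p : ℝ → ℝ) (t : ℝ) :
    P.chargeCost p t (P.chargeTime (p t)) = P.δbar * P.pbar - P.saving (p t) := by
  rw [chargeCost_eq]
  rcases le_or_gt (p t) P.α with h | h
  · rw [P.saving_of_le h, P.chargeTime_of_le h]; simp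
  · have h1 := P.saving_sub_gain h (P.chargeTime (p t))
    simp at h1
    linarith

/-- The optimal charging time is unique. -/
lemma eq_chargeTime {p : ℝ → ℝ} {t δ : ℝ} (hp : 0 ≤ p t) (hδ : 0 ≤ δ)
    (h : P.chargeCost p t δ ≤ P.δbar * P.pbar - P.saving (p t)) :
    δ = P.chargeTime (p t) := by
  have hD := P.δbar_pos
  have hα := P.α_pos
  rw [chargeCost_eq] at h
  rcases le_or_gt (p t) P.α with h' | h'
  · rw [P.saving_of_le h'] at h
    rw [P.chargeTime_of_le h']
    by_contra hne
    have hδ' : 0 < δ := lt_of_le_of_ne hδ (Ne.symm hne)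
    rcases h'.eq_or_lt with h'' | h''
    · rw [h''] at h
      have : 0 < P.α * δ ^ 2 / (2 * P.δbar) := by positivity
      nlinarith
    · have : 0 ≤ p t * δ ^ 2 / (2 * P.δbar) := by positivity
      nlinarith [mul_pos (sub_pos.2 h'') hδ']
  · have h1 := P.saving_sub_gain h' δ
    have h2 : 0 < p t / (2 * P.δbar) := div_pos (hα.trans h') (by positivity)
    have h3 : (δ - P.chargeTime (p t)) ^ 2 ≤ 0 := by
      by_contra! h4
      have := mul_pos h2 h4
      linarith
    have := pow_eq_zero_iff (two_ne_zero) |>.1 (le_antisymm h3 (sq_nonneg _))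
    linarith

lemma outlay_zero : P.outlay 0 = 0 := by simp [outlay]

lemma outlay_strictMonoOn : StrictMonoOn P.outlay (Ici 0) := by
  intro a ha b hb hab
  have h := mul_pos P.α_pos P.δbar_pos
  have ha' : 0 ≤ a := ha
  have : √(a ^ 2 + 2 * P.α * P.δbar * a) ≤ √(b ^ 2 + 2 * P.α * P.δbar * b) := by
    apply Real.sqrt_le_sqrt
    nlinarith
  unfold outlay
  linarith

lemma continuous_outlay : Continuous P.outlay := by
  unfold outlay
  fun_prop

lemma chargeTime_mul {q : ℝ} (hq : 0 ≤ q) :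
    P.chargeTime q * q = P.δbar * max (q - P.α) 0 := by
  rcases hq.eq_or_lt with rfl | h
  · simp [P.α_pos.le]
  · rw [chargeTime, div_mul_cancel₀ _ h.ne']

lemma outlay_saving (q : ℝ) :
    P.outlay (P.saving q) = P.δbar * max (q - P.α) 0 := by
  have hD := P.δbar_pos
  have hα := P.α_pos
  rcases le_or_gt q P.α with h | h
  · rw [P.saving_of_le h, outlay_zero, max_eq_right (sub_nonpos.2 h), mul_zero]
  · have hq' : 0 < q := hα.trans h
    have h0 : 0 ≤ q - P.α := sub_nonneg.2 h.le
    have : P.saving q ^ 2 + 2 * P.α * P.δbar * P.saving q =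
        (P.δbar * (q - P.α) * (q + P.α) / (2 * q)) ^ 2 := by
      rw [saving, max_eq_left h0]
      field_simp
      ring
    rw [outlay, this, Real.sqrt_sq (by positivity), saving, max_eq_left h0]
    field_simp
    ring

lemma priceOf_neg {v : ℝ} : P.priceOf (-v) = P.α + P.outlay v / P.δbar := by
  have hD := P.δbar_pos
  have : (-v / P.δbar - P.α) ^ 2 - P.α ^ 2 =
      (v ^ 2 + 2 * P.α * P.δbar * v) / P.δbar ^ 2 := by
    field_simp
    ring
  rw [priceOf, outlay, this, Real.sqrt_div' _ (by positivity), Real.sqrt_sq hD.le]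
  ring

lemma outlay_nonneg {v : ℝ} (hv : 0 ≤ v) : 0 ≤ P.outlay v := by
  unfold outlay; positivity

lemma saving_priceOf {v : ℝ} (hv : 0 ≤ v) : P.saving (P.priceOf (-v)) = v := by
  have hD := P.δbar_pos
  have hα := P.α_pos
  have ho := P.outlay_nonneg hv
  have hw : √(v ^ 2 + 2 * P.α * P.δbar * v) ^ 2 = v ^ 2 + 2 * P.α * P.δbar * v :=
    Real.sq_sqrt (by positivity)
  have hq : 0 < P.α + P.outlay v / P.δbar := by positivity
  have ho2 : P.outlay v ^ 2 = 2 * v * (P.α * P.δbar + P.outlay v) := by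
    unfold outlay
    linear_combination hw
  rw [priceOf_neg, saving, add_sub_cancel_left, max_eq_left (by positivity),
    div_eq_iff (by positivity)]
  field_simp
  linear_combination ho2

/-- The discount is determined by its perceived value, when that is positive. -/
lemma eq_priceOf {q v : ℝ} (hv : 0 < v) (h : P.saving q = v) :
    q = P.priceOf (-v) := by
  have hqα : P.α < q := by
    by_contra! h'
    rw [P.saving_of_le h'] at h
    exact hv.ne h
  rw [priceOf_neg, ← h, P.outlay_saving q, max_eq_left (sub_nonneg.2 hqα.le),
    mul_div_cancel_left₀ _ P.δbar_pos.ne']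
  ring

lemma le_of_saving_eq_zero {q : ℝ} (h : P.saving q = 0) : q ≤ P.α := by
  by_contra! h'
  have : 0 < P.saving q := by
    have := P.δbar_pos
    have h0 := P.α_pos.trans h'
    have h1 : 0 < q - P.α := sub_pos.2 h'
    rw [saving, max_eq_left h1.le]
    positivity
  exact this.ne' h

/-! ### Closed forms in terms of the equilibrium travel cost -/

/-- Schedule delay cost of arriving at time `y`. -/
def sched (y : ℝ) : ℝ := max (P.β * (P.tStar - y)) (P.γ * (y - P.tStar))

/-- The schedule delay cost of arriving at `0` or at `N/s`, which is the equilibrium cost without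
incentives. -/
def maxCost : ℝ := P.β * P.γ * P.N / (P.s * (P.β + P.γ))

/-- The amount by which a perceived budget `m` lowers the equilibrium travel cost. -/
def drop (m : ℝ) : ℝ := √(2 * P.β * P.γ * m / (P.s * (P.β + P.γ)))

/-- The equilibrium travel cost net of the perceived gain, for a perceived budget `m`. -/
def level (m : ℝ) : ℝ := P.maxCost - P.drop m

/-- The least waiting time at `t` for which the travel cost is at least `c`. -/
def waitAt (c t : ℝ) : ℝ :=
  max 0 (min ((c - P.β * (P.tStar - t)) / (P.α - P.β)) ((c - P.γ * (t - P.tStar)) / (P.α + P.γ)))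

lemma maxCost_pos : 0 < P.maxCost := by
  have := P.β_pos; have := P.γ_pos; have := P.N_pos; have := P.s_pos
  unfold maxCost; positivity

lemma β_mul_tStar : P.β * P.tStar = P.maxCost := by
  unfold tStar maxCost; ring

lemma γ_mul_horizon_sub : P.γ * (P.horizon - P.tStar) = P.maxCost := by
  have := P.β_pos; have := P.γ_pos; have := P.s_pos
  unfold tStar maxCost horizon
  field_simp
  ring

lemma tStar_pos : 0 < P.tStar := by
  have := P.β_pos; have := P.γ_pos; have := P.N_pos; have := P.s_pos
  unfold tStar; positivity

lemma tStar_lt_horizon : P.tStar < P.horizon := by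
  have h := P.γ_mul_horizon_sub ▸ P.maxCost_pos
  have := (mul_pos_iff_of_pos_left P.γ_pos).1 h
  linarith

lemma continuous_sched : Continuous P.sched := by unfold sched; fun_prop

lemma sched_nonneg (y : ℝ) : 0 ≤ P.sched y := by
  have hβ := P.β_pos; have hγ := P.γ_pos
  unfold sched
  rcases le_total y P.tStar with h | h
  · exact le_max_of_le_left (mul_nonneg hβ.le (sub_nonneg.2 h))
  · exact le_max_of_le_right (mul_nonneg hγ.le (sub_nonneg.2 h))

lemma sched_tStar : P.sched P.tStar = 0 := by simp [sched]

lemma sched_zero : P.sched 0 = P.maxCost := by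
  have := P.β_mul_tStar
  have h := mul_pos P.γ_pos P.tStar_pos
  have := P.maxCost_pos
  rw [sched, max_eq_left] <;> linarith

lemma sched_horizon : P.sched P.horizon = P.maxCost := by
  have h1 := P.γ_mul_horizon_sub
  have h := mul_pos P.β_pos (sub_pos.2 P.tStar_lt_horizon)
  have := P.maxCost_pos
  rw [sched, max_eq_right] <;> linarith

lemma sched_le_iff {c y : ℝ} :
    P.sched y ≤ c ↔ P.tStar - c / P.β ≤ y ∧ y ≤ P.tStar + c / P.γ := by
  have hβ := P.β_pos; have hγ := P.γ_pos
  rw [sched, max_le_iff, ← le_div_iff₀' hβ, ← le_div_iff₀' hγ]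
  constructor <;> rintro ⟨h1, h2⟩ <;> constructor <;> linarith

lemma maxCost_div_β : P.maxCost / P.β = P.tStar := by
  rw [← β_mul_tStar, mul_div_cancel_left₀ _ P.β_pos.ne']

lemma maxCost_div_γ : P.maxCost / P.γ = P.horizon - P.tStar := by
  rw [← γ_mul_horizon_sub, mul_div_cancel_left₀ _ P.γ_pos.ne']

lemma sched_le_maxCost_iff {y : ℝ} : P.sched y ≤ P.maxCost ↔ y ∈ Icc 0 P.horizon := by
  rw [sched_le_iff, maxCost_div_β, maxCost_div_γ, mem_Icc, sub_self, add_sub_cancel]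

/-- A commuter who departs at `t` and waits for `w` has travel cost `α * w + sched (t + w)`. -/
lemma travelCost_eq (r : ℝ → ℝ) (t : ℝ) :
    P.travelCost r t = P.α * P.wait r t + P.sched (t + P.wait r t) := by
  unfold travelCost sched
  congr 2 <;> ring

lemma mul_add_sched (t w : ℝ) : P.α * w + P.sched (t + w) =
    max ((P.α - P.β) * w + P.β * (P.tStar - t)) ((P.α + P.γ) * w + P.γ * (t - P.tStar)) := by
  rw [sched, ← max_add_add_left]
  congr 1 <;> ring

lemma mul_add_sched_strictMono (t : ℝ) : StrictMono fun w => P.α * w + P.sched (t + w) := by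
  intro a b hab
  have h1 := mul_lt_mul_of_pos_left hab (sub_pos.2 P.β_lt_α)
  have h2 := mul_lt_mul_of_pos_left hab (add_pos P.α_pos P.γ_pos)
  simp only [mul_add_sched]
  apply max_lt_max <;> linarith

lemma waitAt_nonneg (c t : ℝ) : 0 ≤ P.waitAt c t := le_max_left _ _

lemma continuous_waitAt (c : ℝ) : Continuous (P.waitAt c) := by unfold waitAt; fun_prop

lemma mul_add_sched_waitAt (c t : ℝ) :
    P.α * P.waitAt c t + P.sched (t + P.waitAt c t) = max c (P.sched t) := by
  have h1 := sub_pos.2 P.β_lt_α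
  have h2 := add_pos P.α_pos P.γ_pos
  rcases le_total c (P.sched t) with h | h
  · have : P.waitAt c t = 0 := by
      refine max_eq_left ?_
      rw [sched, le_max_iff] at h
      rcases h with h | h
      · exact min_le_of_left_le (div_nonpos_of_nonpos_of_nonneg (by linarith) h1.le)
      · exact min_le_of_right_le (div_nonpos_of_nonpos_of_nonneg (by linarith) h2.le)
    rw [this, max_eq_right h]; simp
  · rw [max_eq_left h]
    rw [sched, max_le_iff] at h
    have : P.waitAt c t = min ((c - P.β * (P.tStar - t)) / (P.α - P.β))
        ((c - P.γ * (t - P.tStar)) / (P.α + P.γ)) :=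
      max_eq_right (le_min (div_nonneg (by linarith) h1.le) (div_nonneg (by linarith) h2.le))
    rw [this, mul_add_sched]
    rcases le_total ((c - P.β * (P.tStar - t)) / (P.α - P.β))
        ((c - P.γ * (t - P.tStar)) / (P.α + P.γ)) with h' | h'
    · rw [min_eq_left h', mul_div_cancel₀ _ h1.ne']
      rw [le_div_iff₀' h2] at h'
      rw [max_eq_left] <;> linarith
    · rw [min_eq_right h', mul_div_cancel₀ _ h2.ne']
      rw [le_div_iff₀' h1] at h'
      rw [max_eq_right] <;> linarith

lemma waitAt_le {c t w : ℝ} (hw : 0 ≤ w) (h : c ≤ P.α * w + P.sched (t + w)) :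
    P.waitAt c t ≤ w := by
  rw [← (P.mul_add_sched_strictMono t).le_iff_le]
  simp only [mul_add_sched_waitAt]
  refine max_le h ?_
  simpa using (P.mul_add_sched_strictMono t).monotone hw

lemma eq_waitAt {c t w : ℝ} (h : P.α * w + P.sched (t + w) = max c (P.sched t)) :
    w = P.waitAt c t :=
  (P.mul_add_sched_strictMono t).injective (h.trans (P.mul_add_sched_waitAt c t).symm)

lemma waitAt_eq_zero {c t : ℝ} (h : c ≤ P.sched t) : P.waitAt c t = 0 :=
  (P.eq_waitAt (by simp [h])).symm

lemma add_waitAt_eq (c t : ℝ) : t + P.waitAt c t =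
    max t (min ((P.α * t + c - P.β * P.tStar) / (P.α - P.β))
      ((P.α * t + c + P.γ * P.tStar) / (P.α + P.γ))) := by
  have h1 := sub_pos.2 P.β_lt_α
  have h2 := add_pos P.α_pos P.γ_pos
  rw [waitAt, ← max_add_add_left, ← min_add_add_left, add_zero]
  congr 2 <;> field_simp <;> ring

lemma add_waitAt_strictMono (c : ℝ) : StrictMono fun t => t + P.waitAt c t := by
  intro a b hab
  have h0 := P.α_pos
  have h1 := sub_pos.2 P.β_lt_α
  have h2 := add_pos P.α_pos P.γ_pos
  simp only [add_waitAt_eq]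
  apply max_lt_max hab (min_lt_min _ _) <;> gcongr

lemma add_waitAt_eq_tStar_iff {c t : ℝ} (hc : 0 ≤ c) :
    t + P.waitAt c t = P.tStar ↔ t = P.tStar - c / P.α := by
  have h0 := P.α_pos
  have : P.tStar - c / P.α + P.waitAt c (P.tStar - c / P.α) = P.tStar := by
    have : P.waitAt c (P.tStar - c / P.α) = c / P.α := by
      refine (P.eq_waitAt ?_).symm
      rw [sub_add_cancel, sched_tStar, mul_div_cancel₀ _ h0.ne', add_zero, max_eq_left]
      have h3 := P.β_lt_α
      rw [sched, sub_sub_cancel]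
      refine max_le ?_ ?_
      · rw [mul_div_assoc', div_le_iff₀ h0]; nlinarith
      · have := mul_nonneg P.γ_pos.le (div_nonneg hc h0.le)
        linarith
    rw [this]; ring
  rw [← (P.add_waitAt_strictMono c).injective.eq_iff (b := P.tStar - c / P.α)]
  simp only [this]

/-! ### Parameters of the closed form -/

lemma drop_nonneg (m : ℝ) : 0 ≤ P.drop m := Real.sqrt_nonneg _

lemma drop_zero : P.drop 0 = 0 := by simp [drop]

lemma level_zero : P.level 0 = P.maxCost := by simp [level, drop_zero]

lemma drop_sq {m : ℝ} (hm : 0 ≤ m) :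
    P.drop m ^ 2 = 2 * P.β * P.γ * m / (P.s * (P.β + P.γ)) := by
  have := P.β_pos; have := P.γ_pos; have := P.s_pos
  exact Real.sq_sqrt (by positivity)

lemma drop_perceivedMax : P.drop P.perceivedMax = P.maxCost := by
  have := P.β_pos; have := P.γ_pos; have := P.s_pos
  have h : 2 * P.β * P.γ * P.perceivedMax / (P.s * (P.β + P.γ)) = P.maxCost ^ 2 := by
    unfold perceivedMax maxCost
    field_simp
  rw [drop, h, Real.sqrt_sq P.maxCost_pos.le]

lemma level_perceivedMax : P.level P.perceivedMax = 0 := by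
  rw [level, drop_perceivedMax, sub_self]

lemma perceivedMax_pos : 0 < P.perceivedMax := by
  have := P.β_pos; have := P.γ_pos; have := P.s_pos; have := P.N_pos
  unfold perceivedMax; positivity

lemma drop_strictMonoOn : StrictMonoOn P.drop (Ici 0) := by
  intro a ha b hb hab
  have := P.β_pos; have := P.γ_pos; have := P.s_pos
  have ha' : 0 ≤ a := ha
  unfold drop
  apply Real.sqrt_lt_sqrt
  · positivity
  · gcongr

lemma continuous_drop : Continuous P.drop := by unfold drop; fun_prop

lemma level_strictAntiOn : StrictAntiOn P.level (Ici 0) := fun _ ha _ hb hab =>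
  sub_lt_sub_left (P.drop_strictMonoOn ha hb hab) _

lemma level_le (m : ℝ) : P.level m ≤ P.maxCost := sub_le_self _ (P.drop_nonneg m)

lemma level_nonneg {m : ℝ} (hm : m ∈ Icc 0 P.perceivedMax) : 0 ≤ P.level m := by
  rw [← level_perceivedMax]
  exact P.level_strictAntiOn.antitoneOn hm.1 (hm.1.trans hm.2) hm.2

lemma tLeft_eq_div (m : ℝ) : P.tLeft m = P.drop m / P.β := by
  have hβ := P.β_pos; have := P.γ_pos; have := P.s_pos
  have h : 2 * P.β * P.γ * m / (P.s * (P.β + P.γ)) =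
      2 * P.γ * m / (P.s * P.β * (P.β + P.γ)) * P.β ^ 2 := by field_simp
  rw [tLeft, drop, h, Real.sqrt_mul' _ (sq_nonneg _), Real.sqrt_sq hβ.le,
    mul_div_cancel_right₀ _ hβ.ne']

lemma tRight_eq_sub_div (m : ℝ) : P.tRight m = P.horizon - P.drop m / P.γ := by
  have := P.β_pos; have hγ := P.γ_pos; have := P.s_pos
  have h : 2 * P.β * P.γ * m / (P.s * (P.β + P.γ)) =
      2 * P.β * m / (P.s * P.γ * (P.β + P.γ)) * P.γ ^ 2 := by field_simp
  rw [tRight, drop, horizon, h, Real.sqrt_mul' _ (sq_nonneg _), Real.sqrt_sq hγ.le,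
    mul_div_cancel_right₀ _ hγ.ne']

lemma tLeft_eq (m : ℝ) : P.tLeft m = P.tStar - P.level m / P.β := by
  rw [tLeft_eq_div, level, sub_div, maxCost_div_β]; ring

lemma tRight_eq (m : ℝ) : P.tRight m = P.tStar + P.level m / P.γ := by
  rw [tRight_eq_sub_div, level, sub_div, maxCost_div_γ]; ring

lemma tPrime_eq : P.tPrime = P.tStar - P.maxCost / P.α := by
  have := P.α_pos; have := P.β_pos; have := P.γ_pos; have := P.s_pos
  unfold tPrime maxCost
  field_simp

lemma tPeak_eq (m : ℝ) : P.tPeak m = P.tStar - P.level m / P.α := by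
  rw [tPeak, tPrime_eq, level, ← drop]; ring

lemma sched_le_level_iff {m y : ℝ} :
    P.sched y ≤ P.level m ↔ P.tLeft m ≤ y ∧ y ≤ P.tRight m := by
  rw [sched_le_iff, tLeft_eq, tRight_eq]

lemma tLeft_le_tPeak {m : ℝ} (hm : m ∈ Icc 0 P.perceivedMax) : P.tLeft m ≤ P.tPeak m := by
  rw [tLeft_eq, tPeak_eq]
  have := div_le_div_of_nonneg_left (P.level_nonneg hm) P.β_pos P.β_lt_α.le
  linarith

lemma tPeak_le_tRight {m : ℝ} (hm : m ∈ Icc 0 P.perceivedMax) : P.tPeak m ≤ P.tRight m := by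
  rw [tRight_eq, tPeak_eq]
  have := div_nonneg (P.level_nonneg hm) P.α_pos.le
  have := div_nonneg (P.level_nonneg hm) P.γ_pos.le
  linarith

/-- The discount is chosen so that its perceived gain makes up for the schedule delay cost in
excess of the equilibrium cost. -/
lemma limitedDiscount_of_notMem {m t : ℝ} (h : t ∉ Ioo (P.tLeft m) (P.tRight m))
    (hm : m ∈ Icc 0 P.perceivedMax) :
    P.limitedDiscount m t = P.priceOf (-max (P.sched t - P.level m) 0) := by
  have hlr := (P.tLeft_le_tPeak hm).trans (P.tPeak_le_tRight hm)
  have hβ := P.β_pos; have hγ := P.γ_pos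
  have hl : P.β * P.tLeft m = P.β * P.tStar - P.level m := by rw [tLeft_eq]; field_simp
  have hr : P.γ * P.tRight m = P.γ * P.tStar + P.level m := by rw [tRight_eq]; field_simp
  have hc := P.level_nonneg hm
  rw [limitedDiscount, if_neg h]
  congr 1
  split_ifs with h1
  · have h2 := mul_le_mul_of_nonneg_left h1 hβ.le
    have h3 : P.sched t = P.β * (P.tStar - t) := by
      refine max_eq_left ?_
      have : t ≤ P.tStar := by
        rw [tLeft_eq] at h1
        have := div_nonneg hc hβ.le
        linarith
      have := mul_nonneg hβ.le (sub_nonneg.2 this)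
      have := mul_nonneg hγ.le (sub_nonneg.2 ‹t ≤ P.tStar›)
      linarith
    rw [h3, max_eq_left] <;> linarith
  · have h1' : P.tRight m ≤ t := by
      by_contra! h'
      exact h ⟨not_le.1 h1, h'⟩
    have h2 := mul_le_mul_of_nonneg_left h1' hγ.le
    have h3 : P.sched t = P.γ * (t - P.tStar) := by
      refine max_eq_right ?_
      have : P.tStar ≤ t := by
        rw [tRight_eq] at h1'
        have := div_nonneg hc hγ.le
        linarith
      have := mul_nonneg hβ.le (sub_nonneg.2 this)
      have := mul_nonneg hγ.le (sub_nonneg.2 ‹P.tStar ≤ t›)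
      linarith
    rw [h3, max_eq_left] <;> linarith

lemma saving_limitedDiscount {m : ℝ} (hm : m ∈ Icc 0 P.perceivedMax) (t : ℝ) :
    P.saving (P.limitedDiscount m t) = max (P.sched t - P.level m) 0 := by
  by_cases h : t ∈ Ioo (P.tLeft m) (P.tRight m)
  · rw [limitedDiscount, if_pos h, P.saving_of_le P.α_pos.le, max_eq_right]
    exact sub_nonpos.2 (P.sched_le_level_iff.2 ⟨h.1.le, h.2.le⟩)
  · rw [P.limitedDiscount_of_notMem h hm, P.saving_priceOf (le_max_right _ _)]

lemma limitedDiscount_isDiscount {m : ℝ} (hm : m ∈ Icc 0 P.perceivedMax) :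
    P.IsDiscount (P.limitedDiscount m) := by
  constructor
  · unfold limitedDiscount
    refine Measurable.ite measurableSet_Ioo measurable_const ?_
    have : Measurable P.priceOf := by unfold priceOf; fun_prop
    refine this.comp (Measurable.ite measurableSet_Iic ?_ ?_) <;> fun_prop
  · intro t _
    by_cases h : t ∈ Ioo (P.tLeft m) (P.tRight m)
    · rw [limitedDiscount, if_pos h]
    · rw [P.limitedDiscount_of_notMem h hm, priceOf_neg]
      have := P.outlay_nonneg (le_max_right (P.sched t - P.level m) 0)
      have := P.α_pos; have := P.δbar_pos
      positivity

lemma limitedRate_pos (m t : ℝ) : 0 < P.limitedRate m t := by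
  have h0 := P.α_pos; have hγ := P.γ_pos; have hs := P.s_pos
  have h1 := sub_pos.2 P.β_lt_α
  unfold limitedRate
  split_ifs <;> positivity

lemma measurable_limitedRate (m : ℝ) : Measurable (P.limitedRate m) := by
  unfold limitedRate
  exact Measurable.ite measurableSet_Ioc measurable_const
    (Measurable.ite measurableSet_Ioo measurable_const measurable_const)

lemma limitedRate_intervalIntegrable (m a b : ℝ) :
    IntervalIntegrable (P.limitedRate m) volume a b := by
  rw [intervalIntegrable_iff]
  refine Measure.integrableOn_of_bounded (M := P.α * P.s / (P.α - P.β)) (by simp)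
    (P.measurable_limitedRate m).aestronglyMeasurable (ae_of_all _ fun t => ?_)
  rw [Real.norm_of_nonneg (P.limitedRate_pos m t).le]
  have h0 := P.α_pos; have hγ := P.γ_pos; have hs := P.s_pos; have hβ := P.β_pos
  have h1 := sub_pos.2 P.β_lt_α
  unfold limitedRate
  split_ifs
  · exact le_rfl
  · gcongr; linarith
  · rw [le_div_iff₀ h1]; nlinarith

/-- The closed-form departure rate is `s` times the derivative of the arrival time. -/
lemma integral_limitedRate {m : ℝ} (hm : m ∈ Icc 0 P.perceivedMax) {a b : ℝ} :
    ∫ t in a..b, P.limitedRate m t =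
      P.s * (b + P.waitAt (P.level m) b) - P.s * (a + P.waitAt (P.level m) a) := by
  have h0 := P.α_pos; have hγ := P.γ_pos; have hs := P.s_pos; have hβ := P.β_pos
  have h1 := sub_pos.2 P.β_lt_α
  have h2 := add_pos h0 hγ
  have hlp := P.tLeft_le_tPeak hm
  have hpr := P.tPeak_le_tRight hm
  set c := P.level m with hc
  have hl : P.tLeft m = P.tStar - c / P.β := P.tLeft_eq m
  have hr : P.tRight m = P.tStar + c / P.γ := P.tRight_eq m
  have hp : P.tPeak m = P.tStar - c / P.α := P.tPeak_eq m
  refine integral_eq_of_hasDerivAt_off_countable (fun t => P.s * (t + P.waitAt c t)) _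
    (s := {P.tLeft m, P.tPeak m, P.tRight m}) (Set.toFinite _).countable
    (Continuous.continuousOn (by have := P.continuous_waitAt c; fun_prop)) (fun x hx => ?_)
    (P.limitedRate_intervalIntegrable m a b)
  simp only [mem_sdiff, mem_insert_iff, mem_singleton_iff, not_or] at hx
  obtain ⟨-, hxl, hxp, hxr⟩ := hx
  have hid : HasDerivAt (fun t => P.s * t) P.s x := by
    simpa using (hasDerivAt_id x).const_mul P.s
  have hout (h : x < P.tLeft m ∨ P.tRight m < x) :
      HasDerivAt (fun t => P.s * (t + P.waitAt c t)) (P.limitedRate m x) x := by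
    have : P.limitedRate m x = P.s := by
      rw [limitedRate, if_neg, if_neg]
      · rintro ⟨h3, h4⟩; rcases h with h | h <;> linarith
      · rintro ⟨h3, h4⟩; rcases h with h | h <;> linarith
    rw [this]
    refine hid.congr_of_eventuallyEq ?_
    have : ∀ᶠ t in nhds x, t < P.tLeft m ∨ P.tRight m < t := by
      rcases h with h | h
      · exact (eventually_lt_nhds h).mono fun _ => Or.inl
      · exact (eventually_gt_nhds h).mono fun _ => Or.inr
    filter_upwards [this] with t ht
    rw [P.waitAt_eq_zero, add_zero]
    by_contra! h'
    have := P.sched_le_level_iff.1 h'.le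
    rcases ht with h | h <;> linarith
  rcases lt_or_gt_of_ne hxl with h | h
  · exact hout (Or.inl h)
  rcases lt_or_gt_of_ne hxr with h' | h'
  swap
  · exact hout (Or.inr h')
  have hW : ∀ t, P.tLeft m < t → t < P.tRight m →
      t + P.waitAt c t = min ((P.α * t + c - P.β * P.tStar) / (P.α - P.β))
      ((P.α * t + c + P.γ * P.tStar) / (P.α + P.γ)) := by
    intro t ht ht'
    rw [add_waitAt_eq, max_eq_right]
    rw [hl, sub_lt_comm, lt_div_iff₀' hβ] at ht
    rw [hr, ← sub_lt_iff_lt_add', lt_div_iff₀' hγ] at ht'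
    refine le_min ?_ ?_
    · rw [le_div_iff₀ h1]; linarith
    · rw [le_div_iff₀ h2]; linarith
  have hcmp : ∀ t, (P.α * t + c - P.β * P.tStar) / (P.α - P.β) ≤
      (P.α * t + c + P.γ * P.tStar) / (P.α + P.γ) ↔ t ≤ P.tPeak m := by
    intro t
    have h3 : t ≤ P.tPeak m ↔ 0 ≤ (P.β + P.γ) * (P.α * (P.tStar - t) - c) := by
      rw [mul_nonneg_iff_of_pos_left (by positivity), hp, le_sub_comm, div_le_iff₀' h0, sub_nonneg]
    rw [h3, div_le_div_iff₀ h1 h2, ← sub_nonneg]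
    ring_nf
  have hlin (e k : ℝ) : HasDerivAt (fun t => P.s * ((P.α * t + e) / k)) (P.α * P.s / k) x := by
    have := ((((hasDerivAt_id x).const_mul P.α).add_const e).div_const k).const_mul P.s
    refine this.congr_deriv ?_
    ring
  rcases lt_or_gt_of_ne hxp with h'' | h''
  · rw [limitedRate, if_pos ⟨h, h''.le⟩]
    refine (hlin (c - P.β * P.tStar) _).congr_of_eventuallyEq ?_
    filter_upwards [eventually_gt_nhds h, eventually_lt_nhds h', eventually_lt_nhds h'']
      with t ht ht' ht''
    rw [hW t ht ht', min_eq_left ((hcmp t).2 ht''.le), add_sub_assoc]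
  · rw [limitedRate, if_neg (fun h => h''.not_ge h.2), if_pos ⟨h'', h'⟩]
    refine (hlin (c + P.γ * P.tStar) _).congr_of_eventuallyEq ?_
    filter_upwards [eventually_gt_nhds h, eventually_lt_nhds h', eventually_gt_nhds h'']
      with t ht ht' ht''
    rw [hW t ht ht', min_eq_right (le_of_not_ge fun h => ht''.not_ge ((hcmp t).1 h)), add_assoc]

end Bottleneck

/-! ### Measures bounded by a multiple of Lebesgue measure -/

lemma measure_le_smul_volume {ν : Measure ℝ} {c : NNReal}
    (h : ∀ a b, ν (Ioc a b) ≤ c * ENNReal.ofReal (b - a)) : ν ≤ c • volume := by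
  rw [Real.volume_eq_stieltjes_id, ← StieltjesFunction.measure_smul]
  refine Measure.le_iff'.2 fun A => ?_
  set F := c • StieltjesFunction.id
  have hF : F.measure A = F.outer A := by rw [StieltjesFunction.measure]; rfl
  rw [hF]
  refine OuterMeasure.le_ofFunction (μ := ν.toOuterMeasure).2 (fun B => ?_) A
  rw [StieltjesFunction.length_eq]
  refine le_iInf fun a => le_iInf fun b => le_iInf fun hB => ?_
  have hbot : botSet (R := ℝ) = ∅ := by
    ext x
    simp [botSet]
  rw [hbot, sdiff_empty] at hB
  refine (measure_mono hB).trans ((h a b).trans_eq ?_)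
  have : F b - F a = c * (b - a) := (mul_sub (c : ℝ) b a).symm
  rw [this, ENNReal.ofReal_mul c.coe_nonneg]
  simp

/-- If the mass `∫ r` of every interval is at most `K` times the increment of `a`, then the image
under `a` of the measure with density `r` is at most `K` times Lebesgue measure. -/
lemma lintegral_mul_comp_le {r a : ℝ → ℝ} {H : ℝ} {K : NNReal}
    (hr : ∀ t ∈ Icc 0 H, 0 ≤ r t) (hri : IntegrableOn r (Icc 0 H))
    (ha : ContinuousOn a (Icc 0 H))
    (h : ∀ u ∈ Icc 0 H, ∀ t ∈ Icc 0 H, u ≤ t → ∫ τ in u..t, r τ ≤ K * (a t - a u))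
    {ψ : ℝ → ENNReal} (hψ : Measurable ψ) :
    ∫⁻ t in Icc 0 H, ENNReal.ofReal (r t) * ψ (a t) ≤ K * ∫⁻ y, ψ y := by
  set ρ : Measure ℝ := volume.restrict (Icc 0 H)
  have hrm : AEMeasurable (fun t => ENNReal.ofReal (r t)) ρ :=
    hri.aestronglyMeasurable.aemeasurable.ennreal_ofReal
  have ham : AEMeasurable a ρ := ha.aemeasurable measurableSet_Icc
  set μ := ρ.withDensity fun t => ENNReal.ofReal (r t)
  have ham' : AEMeasurable a μ := ham.mono_ac (withDensity_absolutelyContinuous _ _)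
  have key : μ.map a ≤ K • volume := by
    refine measure_le_smul_volume fun x y => ?_
    rw [Measure.map_apply_of_aemeasurable ham' measurableSet_Ioc]
    set C := Icc 0 H ∩ a ⁻¹' Icc x y
    have hC : IsClosed C := ha.preimage_isClosed_of_isClosed isClosed_Icc isClosed_Icc
    have hCc : IsCompact C := isCompact_Icc.of_isClosed_subset hC inter_subset_left
    have hsub : μ (a ⁻¹' Ioc x y) ≤ μ C := by
      have : μ (Icc 0 H)ᶜ = 0 := by
        refine withDensity_absolutelyContinuous _ _ ?_
        simp [ρ]
      rw [← measure_inter_conull this]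
      refine measure_mono fun t ht => ⟨ht.2, Ioc_subset_Icc_self ht.1⟩
    refine hsub.trans ?_
    rcases C.eq_empty_or_nonempty with hE | hne
    · rw [hE]; simp
    obtain ⟨u, hu, hul⟩ := hCc.exists_isLeast hne
    obtain ⟨t, ht, htg⟩ := hCc.exists_isGreatest hne
    have hut : u ≤ t := hul ht
    have hsub2 : Icc u t ⊆ Icc 0 H := Icc_subset_Icc hu.1.1 ht.1.2
    have hint : IntegrableOn r (Icc u t) := hri.mono_set hsub2
    calc μ C ≤ μ (Icc u t) := measure_mono fun v hv => ⟨hul hv, htg hv⟩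
      _ = ∫⁻ v in Icc u t, ENNReal.ofReal (r v) := by
        rw [withDensity_apply _ measurableSet_Icc, Measure.restrict_restrict measurableSet_Icc,
          inter_eq_left.2 hsub2]
      _ = ENNReal.ofReal (∫ τ in u..t, r τ) := by
        rw [← ofReal_integral_eq_lintegral_ofReal hint
          ((ae_restrict_iff' measurableSet_Icc).2 (ae_of_all _ fun v hv => hr v (hsub2 hv))),
          intervalIntegral.integral_of_le hut, integral_Icc_eq_integral_Ioc]
      _ ≤ ENNReal.ofReal (K * (y - x)) := by
        refine ENNReal.ofReal_le_ofReal ((h u hu.1 t ht.1 hut).trans ?_)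
        have h1 : a t ≤ y := ht.2.2
        have h2 : x ≤ a u := hu.2.1
        gcongr
      _ = K * ENNReal.ofReal (y - x) := by
        rw [ENNReal.ofReal_mul K.coe_nonneg]; simp
  calc ∫⁻ t, ENNReal.ofReal (r t) * ψ (a t) ∂ρ = ∫⁻ t, ψ (a t) ∂μ :=
        (lintegral_withDensity_eq_lintegral_mul₀ hrm (hψ.comp_aemeasurable ham)).symm
    _ = ∫⁻ y, ψ y ∂μ.map a := (lintegral_map' hψ.aemeasurable ham').symm
    _ ≤ ∫⁻ y, ψ y ∂(K • volume) := lintegral_mono' key le_rfl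
    _ = K * ∫⁻ y, ψ y := by rw [lintegral_smul_measure]; rfl

namespace Bottleneck

variable (P : Bottleneck)

/-! ### The queue -/

/-- The rate `r` is nonnegative and integrable on `[0, N/s]`. These are the properties of an
equilibrium rate on which the estimates of the queue rest. -/
structure IsRate (r : ℝ → ℝ) : Prop where
  nonneg : ∀ t ∈ Icc 0 P.horizon, 0 ≤ r t
  integrable : IntervalIntegrable r volume 0 P.horizon

variable {P}

variable {r : ℝ → ℝ}

lemma queue_le {t B : ℝ} (ht : 0 ≤ t)
    (hB : ∀ u ∈ Icc 0 t, (∫ τ in u..t, r τ) - P.s * (t - u) ≤ B) : P.queue r t ≤ B := by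
  refine csSup_le ((nonempty_Icc.2 ht).image _) ?_
  rintro _ ⟨u, hu, rfl⟩
  exact hB u hu

lemma queue_zero : P.queue r 0 = 0 := by simp [queue]

lemma wait_zero : P.wait r 0 = 0 := by rw [wait, queue_zero, zero_div]

lemma s_mul_wait (t : ℝ) : P.s * P.wait r t = P.queue r t := mul_div_cancel₀ _ P.s_pos.ne'

lemma integral_limitedRate_horizon {m : ℝ} (hm : m ∈ Icc 0 P.perceivedMax) :
    ∫ t in (0 : ℝ)..P.horizon, P.limitedRate m t = P.N := by
  rw [P.integral_limitedRate hm,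
    P.waitAt_eq_zero ((P.level_le m).trans_eq P.sched_zero.symm),
    P.waitAt_eq_zero ((P.level_le m).trans_eq P.sched_horizon.symm), ← P.s_mul_horizon]
  ring

namespace IsRate

lemma intervalIntegrable {a b : ℝ} (h : P.IsRate r)
    (ha : a ∈ Icc 0 P.horizon) (hb : b ∈ Icc 0 P.horizon) : IntervalIntegrable r volume a b := by
  refine h.integrable.mono_set ?_
  rw [uIcc_of_le P.horizon_pos.le]
  exact uIcc_subset_Icc ha hb

lemma integral_nonneg {u t : ℝ} (h : P.IsRate r) (hu : 0 ≤ u) (hut : u ≤ t)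
    (ht : t ≤ P.horizon) : 0 ≤ ∫ τ in u..t, r τ :=
  intervalIntegral.integral_nonneg hut fun v hv => h.nonneg v ⟨hu.trans hv.1, hv.2.trans ht⟩

lemma integral_add {u v t : ℝ} (h : P.IsRate r) (hu : 0 ≤ u) (huv : u ≤ v) (hvt : v ≤ t)
    (ht : t ≤ P.horizon) : (∫ τ in u..v, r τ) + ∫ τ in v..t, r τ = ∫ τ in u..t, r τ :=
  intervalIntegral.integral_add_adjacent_intervals
    (h.intervalIntegrable ⟨hu, by linarith⟩ ⟨by linarith, by linarith⟩)
    (h.intervalIntegrable ⟨by linarith, by linarith⟩ ⟨by linarith, ht⟩)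

lemma le_queue {u t : ℝ} (h : P.IsRate r) (hu : 0 ≤ u) (hut : u ≤ t) (ht : t ≤ P.horizon) :
    (∫ τ in u..t, r τ) - P.s * (t - u) ≤ P.queue r t := by
  refine le_csSup ⟨∫ τ in 0..t, r τ, ?_⟩ ⟨u, ⟨hu, hut⟩, rfl⟩
  rintro _ ⟨v, hv, rfl⟩
  have h1 := h.integral_add le_rfl hv.1 hv.2 ht
  have h2 := h.integral_nonneg le_rfl hv.1 (hv.2.trans ht)
  have h3 := mul_nonneg P.s_pos.le (sub_nonneg.2 hv.2)
  simp only
  linarith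

lemma queue_nonneg {t : ℝ} (h : P.IsRate r) (ht : t ∈ Icc 0 P.horizon) : 0 ≤ P.queue r t := by
  simpa using h.le_queue ht.1 le_rfl ht.2

lemma queue_add_le {u t : ℝ} (h : P.IsRate r) (hu : 0 ≤ u) (hut : u ≤ t) (ht : t ≤ P.horizon) :
    P.queue r u + ((∫ τ in u..t, r τ) - P.s * (t - u)) ≤ P.queue r t := by
  rw [← le_sub_iff_add_le]
  refine queue_le hu fun v hv => ?_
  have h1 := h.integral_add hv.1 hv.2 hut ht
  have h2 := h.le_queue hv.1 (hv.2.trans hut) ht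
  linarith

lemma queue_le_add {u t : ℝ} (h : P.IsRate r) (hu : 0 ≤ u) (hut : u ≤ t) (ht : t ≤ P.horizon) :
    P.queue r t ≤ P.queue r u + ∫ τ in u..t, r τ := by
  have hQ := h.queue_nonneg ⟨hu, hut.trans ht⟩
  refine queue_le (hu.trans hut) fun v hv => ?_
  have hs := mul_nonneg P.s_pos.le (sub_nonneg.2 hv.2)
  rcases le_total v u with h' | h'
  · have h1 := h.integral_add hv.1 h' hut ht
    have h2 := h.le_queue hv.1 h' (hut.trans ht)
    have h3 := mul_nonneg P.s_pos.le (sub_nonneg.2 hut)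
    linarith
  · have h1 := h.integral_add hu h' hv.2 ht
    have h2 := h.integral_nonneg hu h' (hv.2.trans ht)
    linarith

lemma queue_le_of_rate_eq_zero {u t : ℝ} (h : P.IsRate r) (hu : 0 ≤ u) (hut : u ≤ t)
    (ht : t ≤ P.horizon) (h0 : ∀ v ∈ Ioc u t, r v = 0) :
    P.queue r t ≤ max 0 (P.queue r u - P.s * (t - u)) := by
  have hz : ∀ v, u ≤ v → v ≤ t → ∫ τ in v..t, r τ = 0 := fun v huv hvt => by
    rw [intervalIntegral.integral_of_le hvt,
      setIntegral_congr_fun measurableSet_Ioc fun x hx => h0 x ⟨huv.trans_lt hx.1, hx.2⟩]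
    simp
  refine queue_le (hu.trans hut) fun v hv => ?_
  have hs := mul_nonneg P.s_pos.le (sub_nonneg.2 hv.2)
  rcases le_total v u with h' | h'
  · refine le_max_of_le_right ?_
    have h1 := h.integral_add hv.1 h' hut ht
    have h2 := h.le_queue hv.1 h' (hut.trans ht)
    have h3 := hz u le_rfl hut
    linarith
  · refine le_max_of_le_left ?_
    rw [hz v h' hv.2]
    linarith

lemma continuousOn_queue (h : P.IsRate r) : ContinuousOn (P.queue r) (Icc 0 P.horizon) := by
  -- increments of the queue are dominated by those of `W`
  set W : ℝ → ℝ := fun t => (∫ τ in 0..t, r τ) + P.s * t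
  have hW : ContinuousOn W (Icc 0 P.horizon) := by
    have h1 := intervalIntegral.continuousOn_primitive_interval' h.integrable
      (left_mem_uIcc (a := (0 : ℝ)) (b := P.horizon))
    rw [uIcc_of_le P.horizon_pos.le] at h1
    exact h1.add (continuous_const.mul continuous_id).continuousOn
  have hle : ∀ u ∈ Icc 0 P.horizon, ∀ t ∈ Icc 0 P.horizon, u ≤ t →
      |P.queue r t - P.queue r u| ≤ |W t - W u| := by
    intro u hu t ht hut
    have h1 := h.integral_add le_rfl hu.1 hut ht.2
    have h2 := h.queue_add_le hu.1 hut ht.2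
    have h3 := h.queue_le_add hu.1 hut ht.2
    have h4 := h.integral_nonneg hu.1 hut ht.2
    have h5 := mul_nonneg P.s_pos.le (sub_nonneg.2 hut)
    have h6 : W t - W u = (∫ τ in u..t, r τ) + P.s * (t - u) := by simp only [W]; linarith
    rw [h6, abs_of_nonneg (by linarith : 0 ≤ (∫ τ in u..t, r τ) + P.s * (t - u)), abs_le]
    constructor <;> linarith
  rw [Metric.continuousOn_iff] at hW ⊢
  intro u hu ε hε
  obtain ⟨η, hη, hW'⟩ := hW u hu ε hε
  refine ⟨η, hη, fun t ht htu => lt_of_le_of_lt ?_ (hW' t ht htu)⟩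
  rw [Real.dist_eq, Real.dist_eq]
  rcases le_total u t with h' | h'
  · exact hle u hu t ht h'
  · rw [abs_sub_comm, abs_sub_comm (W t)]
    exact hle t ht u hu h'

lemma wait_nonneg {t : ℝ} (h : P.IsRate r) (ht : t ∈ Icc 0 P.horizon) : 0 ≤ P.wait r t :=
  div_nonneg (h.queue_nonneg ht) P.s_pos.le

lemma continuousOn_wait (h : P.IsRate r) : ContinuousOn (P.wait r) (Icc 0 P.horizon) :=
  h.continuousOn_queue.div_const _

/-- The bottleneck serves at most `s` commuters per unit of time. -/
lemma integral_le {u t : ℝ} (h : P.IsRate r) (hu : 0 ≤ u) (hut : u ≤ t) (ht : t ≤ P.horizon) :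
    ∫ τ in u..t, r τ ≤ P.s * ((t + P.wait r t) - (u + P.wait r u)) := by
  have h1 := h.queue_add_le hu hut ht
  rw [← s_mul_wait, ← s_mul_wait] at h1
  linarith

/-- Arrivals have density at most `s`. -/
lemma lintegral_arrival_le (h : P.IsRate r) {ψ : ℝ → ENNReal} (hψ : Measurable ψ) :
    ∫⁻ t in Icc 0 P.horizon, ENNReal.ofReal (r t) * ψ (t + P.wait r t) ≤
      P.s.toNNReal * ∫⁻ y, ψ y := by
  refine lintegral_mul_comp_le h.nonneg ?_ (continuousOn_id.add h.continuousOn_wait) ?_ hψ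
  · exact (intervalIntegrable_iff_integrableOn_Icc_of_le P.horizon_pos.le).1 h.integrable
  · intro u hu t ht hut
    rw [Real.coe_toNNReal _ P.s_pos.le]
    exact h.integral_le hu.1 hut ht.2

/-- If the waiting time of a rate equals that of the closed form, then so does the rate. -/
lemma ae_eq_limitedRate (h : P.IsRate r) (hN : ∫ t in (0 : ℝ)..P.horizon, r t = P.N) {m : ℝ}
    (hm : m ∈ Icc 0 P.perceivedMax)
    (hw : ∀ t ∈ Icc 0 P.horizon, P.wait r t = P.waitAt (P.level m) t) :
    ∀ᵐ t, t ∈ Icc 0 P.horizon → r t = P.limitedRate m t := by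
  have hH := P.horizon_pos.le
  have hle : ∀ u t, 0 ≤ u → u ≤ t → t ≤ P.horizon →
      ∫ τ in u..t, r τ ≤ ∫ τ in u..t, P.limitedRate m τ := by
    intro u t hu hut ht
    have := h.integral_le hu hut ht
    rw [hw u ⟨hu, hut.trans ht⟩, hw t ⟨hu.trans hut, ht⟩] at this
    rw [P.integral_limitedRate hm]
    linarith
  have htot := integral_limitedRate_horizon hm
  have hadd : ∀ u v t, (∫ τ in u..v, P.limitedRate m τ) + ∫ τ in v..t, P.limitedRate m τ =
      ∫ τ in u..t, P.limitedRate m τ := fun u v t =>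
    intervalIntegral.integral_add_adjacent_intervals (P.limitedRate_intervalIntegrable m _ _)
      (P.limitedRate_intervalIntegrable m _ _)
  have heq : ∀ u t, 0 ≤ u → u ≤ t → t ≤ P.horizon →
      ∫ τ in u..t, r τ = ∫ τ in u..t, P.limitedRate m τ := by
    intro u t hu hut ht
    have h1 := hle 0 u le_rfl hu (hut.trans ht)
    have h2 := hle u t hu hut ht
    have h3 := hle t P.horizon (hu.trans hut) ht le_rfl
    have h4 := h.integral_add le_rfl hu hut ht
    have h5 := h.integral_add le_rfl (hu.trans hut) ht le_rfl
    have h6 := hadd 0 u t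
    have h7 := hadd 0 t P.horizon
    linarith
  filter_upwards [h.integrable.ae_hasDerivAt_integral,
    (P.limitedRate_intervalIntegrable m 0 P.horizon).ae_hasDerivAt_integral,
    compl_mem_ae_iff.2 (measure_singleton (0 : ℝ)),
    compl_mem_ae_iff.2 (measure_singleton P.horizon)] with t h1 h2 ht0 htH ht
  rw [uIcc_of_le hH] at h1 h2
  have h0 : (0 : ℝ) ∈ Icc 0 P.horizon := ⟨le_rfl, hH⟩
  refine (h1 ht 0 h0).unique ((h2 ht 0 h0).congr_of_eventuallyEq ?_)
  filter_upwards [Icc_mem_nhds (lt_of_le_of_ne ht.1 (Ne.symm ht0)) (lt_of_le_of_ne ht.2 htH)]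
    with x hx
  exact heq 0 x le_rfl hx.1 hx.2

end IsRate

lemma limitedRate_isRate (m : ℝ) : P.IsRate (P.limitedRate m) :=
  ⟨fun t _ => (P.limitedRate_pos m t).le, P.limitedRate_intervalIntegrable m _ _⟩

lemma wait_limitedRate {m : ℝ} (hm : m ∈ Icc 0 P.perceivedMax) {t : ℝ}
    (ht : t ∈ Icc 0 P.horizon) : P.wait (P.limitedRate m) t = P.waitAt (P.level m) t := by
  have hs := P.s_pos
  have hw0 : P.waitAt (P.level m) 0 = 0 :=
    P.waitAt_eq_zero ((P.level_le m).trans_eq P.sched_zero.symm)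
  rw [wait, div_eq_iff hs.ne']
  apply le_antisymm
  · refine queue_le ht.1 fun u hu => ?_
    rw [P.integral_limitedRate hm]
    have := mul_nonneg hs.le (P.waitAt_nonneg (P.level m) u)
    linarith
  · have := (limitedRate_isRate m).le_queue le_rfl ht.1 ht.2
    rw [P.integral_limitedRate hm, hw0] at this
    linarith

variable (P)

/-! ### Budgets -/

/-- The monetary budget that lowers the equilibrium cost to `c` when nobody has to wait for a
discount. -/
def budgetAt (c : ℝ) : ℝ :=
  P.s * ∫ y in (0 : ℝ)..P.horizon, P.outlay (max (P.sched y - c) 0)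

lemma continuous_outlay_sched (c : ℝ) :
    Continuous fun y => P.outlay (max (P.sched y - c) 0) := by
  have := P.continuous_outlay; have := P.continuous_sched
  fun_prop

lemma outlay_max_mono {a b : ℝ} (h : a ≤ b) : P.outlay (max a 0) ≤ P.outlay (max b 0) :=
  P.outlay_strictMonoOn.monotoneOn (mem_Ici.2 (le_max_right _ _)) (mem_Ici.2 (le_max_right _ _))
    (max_le_max_right _ h)

lemma budgetAt_strictAntiOn : StrictAntiOn P.budgetAt (Iic P.maxCost) := by
  intro a ha b hb hab
  refine mul_lt_mul_of_pos_left ?_ P.s_pos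
  refine intervalIntegral.integral_lt_integral_of_continuousOn_of_le_of_exists_lt P.horizon_pos
    (P.continuous_outlay_sched b).continuousOn (P.continuous_outlay_sched a).continuousOn
    (fun y _ => P.outlay_max_mono (by linarith)) ⟨0, ⟨le_rfl, P.horizon_pos.le⟩, ?_⟩
  have hb' : b ≤ P.maxCost := hb
  rw [sched_zero]
  refine P.outlay_strictMonoOn (mem_Ici.2 (le_max_right _ _)) (mem_Ici.2 (le_max_right _ _)) ?_
  rw [max_eq_left (by linarith), max_eq_left (by linarith)]
  linarith

/-- Both the departures before and those after `tStar` contribute the integral of `G` over the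
perceived gains in `[0, drop m]`. -/
lemma integral_comp_gain {m : ℝ} (hm : m ∈ Icc 0 P.perceivedMax) {G : ℝ → ℝ} (hG : Continuous G)
    (hG0 : G 0 = 0) : ∫ y in (0 : ℝ)..P.horizon, G (max (P.sched y - P.level m) 0) =
      (1 / P.β + 1 / P.γ) * ∫ v in (0 : ℝ)..P.drop m, G v := by
  have hβ := P.β_pos; have hγ := P.γ_pos
  set c := P.level m with hc
  have hc0 : 0 ≤ c := P.level_nonneg hm
  have hc1 : c ≤ P.maxCost := P.level_le m
  set F : ℝ → ℝ := fun v => G (max (v - c) 0)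
  have hFc : Continuous F := by fun_prop
  have hi : ∀ a b, IntervalIntegrable (fun y => F (P.sched y)) volume a b := fun a b =>
    (hFc.comp P.continuous_sched).intervalIntegrable a b
  have hmain : ∫ v in (0 : ℝ)..P.maxCost, F v = ∫ v in (0 : ℝ)..P.drop m, G v := by
    rw [← intervalIntegral.integral_add_adjacent_intervals (hFc.intervalIntegrable 0 c)
      (hFc.intervalIntegrable c P.maxCost)]
    have h1 : ∫ v in (0 : ℝ)..c, F v = 0 := by
      rw [intervalIntegral.integral_congr (g := fun _ => 0)]
      · simp
      · intro v hv
        rw [uIcc_of_le hc0] at hv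
        simp only [F, max_eq_right (sub_nonpos.2 hv.2), hG0]
    have h2 : ∫ v in c..P.maxCost, F v = ∫ v in c..P.maxCost, G (v - c) := by
      refine intervalIntegral.integral_congr fun v hv => ?_
      rw [uIcc_of_le hc1] at hv
      simp only [F, max_eq_left (sub_nonneg.2 hv.1)]
    rw [h1, h2, intervalIntegral.integral_comp_sub_right, zero_add, sub_self]
    congr 1
    rw [hc, level]; ring
  have hl : ∫ y in (0 : ℝ)..P.tStar, F (P.sched y) = P.β⁻¹ * ∫ v in (0 : ℝ)..P.maxCost, F v := by
    have : ∫ y in (0 : ℝ)..P.tStar, F (P.sched y) =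
        ∫ y in (0 : ℝ)..P.tStar, F (P.maxCost - P.β * y) := by
      refine intervalIntegral.integral_congr fun y hy => ?_
      rw [uIcc_of_le P.tStar_pos.le] at hy
      rw [← β_mul_tStar, ← mul_sub, sched, max_eq_left]
      have := mul_nonneg hβ.le (sub_nonneg.2 hy.2)
      have := mul_nonneg hγ.le (sub_nonneg.2 hy.2)
      linarith
    rw [this, intervalIntegral.integral_comp_sub_mul _ hβ.ne', β_mul_tStar]
    simp
  have hr : ∫ y in P.tStar..P.horizon, F (P.sched y) =
      P.γ⁻¹ * ∫ v in (0 : ℝ)..P.maxCost, F v := by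
    have : ∫ y in P.tStar..P.horizon, F (P.sched y) =
        ∫ y in P.tStar..P.horizon, F (P.γ * y - P.γ * P.tStar) := by
      refine intervalIntegral.integral_congr fun y hy => ?_
      rw [uIcc_of_le P.tStar_lt_horizon.le] at hy
      rw [← mul_sub, sched, max_eq_right]
      have := mul_nonneg hβ.le (sub_nonneg.2 hy.1)
      have := mul_nonneg hγ.le (sub_nonneg.2 hy.1)
      linarith
    rw [this, intervalIntegral.integral_comp_mul_sub _ hγ.ne', ← mul_sub P.γ P.horizon,
      γ_mul_horizon_sub]
    simp
  rw [← intervalIntegral.integral_add_adjacent_intervals (hi 0 P.tStar) (hi P.tStar P.horizon),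
    hl, hr, hmain]
  ring

lemma s_mul_drop_sq {m : ℝ} (hm : 0 ≤ m) :
    P.s * ((1 / P.β + 1 / P.γ) * (P.drop m ^ 2 / 2)) = m := by
  have := P.β_pos; have := P.γ_pos; have := P.s_pos
  rw [P.drop_sq hm]
  field_simp
  ring

lemma integral_gain {m : ℝ} (hm : m ∈ Icc 0 P.perceivedMax) :
    P.s * ∫ y in (0 : ℝ)..P.horizon, max (P.sched y - P.level m) 0 = m := by
  have h := P.integral_comp_gain hm continuous_id rfl
  simp only [id, integral_id] at h
  rw [h]
  linear_combination P.s_mul_drop_sq hm.1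

/-- What the authority pays in excess of the perceived gain `v` is `δbar` times this. -/
def excess (v : ℝ) : ℝ := √((P.α + v / P.δbar) ^ 2 - P.α ^ 2)

lemma continuous_excess : Continuous P.excess := by unfold excess; fun_prop

lemma excess_zero : P.excess 0 = 0 := by simp [excess]

lemma outlay_eq (v : ℝ) : P.outlay v = v + P.δbar * P.excess v := by
  have hD := P.δbar_pos
  have h : v ^ 2 + 2 * P.α * P.δbar * v =
      P.δbar ^ 2 * ((P.α + v / P.δbar) ^ 2 - P.α ^ 2) := by
    field_simp
    ring
  rw [outlay, excess, h, Real.sqrt_mul (sq_nonneg _), Real.sqrt_sq hD.le]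

lemma budgetAt_level {m : ℝ} (hm : m ∈ Icc 0 P.perceivedMax) : P.budgetAt (P.level m) =
    m + P.s * P.δbar * ((1 / P.β + 1 / P.γ) * ∫ v in (0 : ℝ)..P.drop m, P.excess v) := by
  have hc := P.continuous_excess
  have : ∫ v in (0 : ℝ)..P.drop m, P.outlay v =
      P.drop m ^ 2 / 2 + P.δbar * ∫ v in (0 : ℝ)..P.drop m, P.excess v := by
    simp only [outlay_eq]
    rw [intervalIntegral.integral_add intervalIntegral.intervalIntegrable_id
      ((hc.intervalIntegrable _ _).const_mul P.δbar), integral_id,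
      intervalIntegral.integral_const_mul]
    ring
  rw [budgetAt, P.integral_comp_gain hm P.continuous_outlay P.outlay_zero, this]
  nth_rw 3 [← P.s_mul_drop_sq hm.1]
  ring

lemma integral_excess (b : ℝ) : ∫ y in P.α..(P.α + b / P.δbar), 2 * √(y ^ 2 - P.α ^ 2) =
    2 / P.δbar * ∫ v in (0 : ℝ)..b, P.excess v := by
  have hD := P.δbar_pos
  simp only [excess]
  rw [intervalIntegral.integral_comp_add_div (fun y => √(y ^ 2 - P.α ^ 2)) hD.ne',
    intervalIntegral.integral_const_mul, zero_div, add_zero, smul_eq_mul]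
  field_simp

lemma f_eq {m : ℝ} (hm : m ∈ Icc 0 P.perceivedMax) : P.f m = P.budgetAt (P.level m) := by
  have hβ := P.β_pos; have hγ := P.γ_pos; have hD := P.δbar_pos
  have h1 : P.tLeft m * P.β = P.drop m := by rw [tLeft_eq_div, div_mul_cancel₀ _ hβ.ne']
  have h2 : P.γ / P.δbar * (P.N / P.s - P.tRight m) = P.drop m / P.δbar := by
    rw [tRight_eq_sub_div, horizon]
    field_simp
    ring
  rw [f, h1, h2, integral_excess, P.budgetAt_level hm]
  field_simp

lemma zero_mem : (0 : ℝ) ∈ Icc 0 P.perceivedMax := ⟨le_rfl, P.perceivedMax_pos.le⟩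

lemma f_zero : P.f 0 = 0 := by
  rw [P.f_eq P.zero_mem, P.budgetAt_level P.zero_mem, drop_zero]
  simp

lemma unlimitedDiscount_eq (t : ℝ) :
    P.unlimitedDiscount t = P.priceOf (-P.sched t) := by
  have hβ := P.β_pos; have hγ := P.γ_pos
  rw [unlimitedDiscount]
  congr 1
  split_ifs with h
  · rw [sched, max_eq_left]
    · ring
    · have := mul_pos hβ (sub_pos.2 h)
      have := mul_pos hγ (sub_pos.2 h)
      linarith
  · rw [sched, max_eq_right]
    · ring
    · have := mul_nonneg hβ.le (sub_nonneg.2 (not_lt.1 h))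
      have := mul_nonneg hγ.le (sub_nonneg.2 (not_lt.1 h))
      linarith

lemma excess_eq {v : ℝ} (hv : 0 ≤ v) :
    (P.priceOf (-v) ^ 2 - P.α ^ 2) / (2 * P.priceOf (-v)) = P.excess v := by
  have hα := P.α_pos; have hD := P.δbar_pos
  have hq : P.priceOf (-v) = P.α + v / P.δbar + P.excess v := by
    rw [priceOf_neg, outlay_eq]
    field_simp
    ring
  have he0 : 0 ≤ P.excess v := Real.sqrt_nonneg _
  have he : P.excess v ^ 2 = (P.α + v / P.δbar) ^ 2 - P.α ^ 2 := by
    refine Real.sq_sqrt (sub_nonneg.2 ?_)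
    have := div_nonneg hv hD.le
    gcongr
    linarith
  have hA : 0 < P.α + v / P.δbar := by positivity
  rw [hq, div_eq_iff (by positivity)]
  linear_combination -he

lemma f_perceivedMax : P.f P.perceivedMax = P.budgetMax := by
  have hm : P.perceivedMax ∈ Icc 0 P.perceivedMax := ⟨P.perceivedMax_pos.le, le_rfl⟩
  rw [P.f_eq hm, P.budgetAt_level hm, budgetMax,
    ← P.integral_comp_gain hm P.continuous_excess P.excess_zero]
  congr 3
  ext t
  rw [unlimitedDiscount_eq, P.excess_eq (P.sched_nonneg t), level_perceivedMax, sub_zero,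
    max_eq_left (P.sched_nonneg t)]

lemma f_strictMonoOn : StrictMonoOn P.f (Icc 0 P.perceivedMax) := by
  intro a ha b hb hab
  rw [P.f_eq ha, P.f_eq hb]
  exact P.budgetAt_strictAntiOn (P.level_le b) (P.level_le a)
    (P.level_strictAntiOn ha.1 hb.1 hab)

lemma continuousOn_f : ContinuousOn P.f (Icc 0 P.perceivedMax) := by
  have hc : Continuous fun m => m + P.s * P.δbar *
      ((1 / P.β + 1 / P.γ) * ∫ v in (0 : ℝ)..P.drop m, P.excess v) := by
    have := (intervalIntegral.continuous_primitive (μ := volume)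
      (fun a b => P.continuous_excess.intervalIntegrable a b) 0).comp P.continuous_drop
    have h2 : Continuous fun m => ∫ v in (0 : ℝ)..P.drop m, P.excess v := this
    fun_prop
  exact hc.continuousOn.congr fun m hm => (P.f_eq hm).trans (P.budgetAt_level hm)

lemma f_bijOn : BijOn P.f (Icc 0 P.perceivedMax) (Icc 0 P.budgetMax) := by
  have hm : P.perceivedMax ∈ Icc 0 P.perceivedMax := ⟨P.perceivedMax_pos.le, le_rfl⟩
  rw [← f_perceivedMax]
  nth_rw 2 [← f_zero]
  refine ⟨fun m h => ⟨P.f_strictMonoOn.monotoneOn P.zero_mem h h.1,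
    P.f_strictMonoOn.monotoneOn h hm h.2⟩, P.f_strictMonoOn.injOn, ?_⟩
  exact intermediate_value_Icc P.perceivedMax_pos.le P.continuousOn_f

lemma fInv_mem {M : ℝ} (hM : M ∈ Icc 0 P.budgetMax) : P.fInv M ∈ Icc 0 P.perceivedMax :=
  Function.invFunOn_mem (P.f_bijOn.surjOn hM)

lemma f_fInv {M : ℝ} (hM : M ∈ Icc 0 P.budgetMax) : P.f (P.fInv M) = M :=
  Function.invFunOn_eq (P.f_bijOn.surjOn hM)

/-! ### Lower bound for the budget -/

variable {P}

lemma IsRate.integral_arrival_le {r : ℝ → ℝ} (h : P.IsRate r) {ψ : ℝ → ℝ} (hψ : Continuous ψ)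
    (h0 : ∀ y, 0 ≤ ψ y) (hout : ∀ y ∉ Icc 0 P.horizon, ψ y = 0) :
    ∫ t in (0 : ℝ)..P.horizon, r t * ψ (t + P.wait r t) ≤
      P.s * ∫ y in (0 : ℝ)..P.horizon, ψ y := by
  have hH := P.horizon_pos.le
  have key := h.lintegral_arrival_le hψ.measurable.ennreal_ofReal
  have hi : IntervalIntegrable (fun t => r t * ψ (t + P.wait r t)) volume 0 P.horizon := by
    refine h.integrable.mul_continuousOn ?_
    rw [uIcc_of_le hH]
    exact hψ.comp_continuousOn (continuousOn_id.add h.continuousOn_wait)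
  have hL : ∫⁻ t in Icc 0 P.horizon, ENNReal.ofReal (r t) * ENNReal.ofReal (ψ (t + P.wait r t)) =
      ENNReal.ofReal (∫ t in (0 : ℝ)..P.horizon, r t * ψ (t + P.wait r t)) := by
    rw [intervalIntegral.integral_of_le hH, ← integral_Icc_eq_integral_Ioc,
      ofReal_integral_eq_lintegral_ofReal
        ((intervalIntegrable_iff_integrableOn_Icc_of_le hH).1 hi)]
    · refine setLIntegral_congr_fun measurableSet_Icc fun t ht => ?_
      exact (ENNReal.ofReal_mul (h.nonneg t ht)).symm
    · exact (ae_restrict_iff' measurableSet_Icc).2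
        (ae_of_all _ fun t ht => mul_nonneg (h.nonneg t ht) (h0 _))
  have hR : ∫⁻ y, ENNReal.ofReal (ψ y) =
      ENNReal.ofReal (∫ y in (0 : ℝ)..P.horizon, ψ y) := by
    rw [intervalIntegral.integral_of_le hH, ← integral_Icc_eq_integral_Ioc,
      ofReal_integral_eq_lintegral_ofReal (hψ.continuousOn.integrableOn_Icc)
        (ae_of_all _ h0), setLIntegral_eq_of_support_subset]
    intro y hy
    by_contra hy'
    exact hy (by simp [hout y hy'])
  rw [hL, hR, ← ENNReal.ofReal, ← ENNReal.ofReal_mul P.s_pos.le] at key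
  · rwa [ENNReal.ofReal_le_ofReal_iff] at key
    exact mul_nonneg P.s_pos.le (intervalIntegral.integral_nonneg hH fun y _ => h0 y)

lemma IsRate.intervalIntegrable_outlay {r : ℝ → ℝ} (h : P.IsRate r) (c : ℝ) :
    IntervalIntegrable (fun t => r t * P.outlay (max (P.sched (t + P.wait r t) - c) 0))
      volume 0 P.horizon := by
  refine h.integrable.mul_continuousOn ?_
  rw [uIcc_of_le P.horizon_pos.le]
  exact (P.continuous_outlay_sched c).comp_continuousOn
    (continuousOn_id.add h.continuousOn_wait)

/-- As at most `s` commuters arrive per unit of time, the cheapest arrival times for `N` commuters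
are those in `[0, N/s]`, which is a sublevel set of the schedule delay cost. -/
lemma IsRate.budgetAt_le {r : ℝ → ℝ} (h : P.IsRate r)
    (hN : ∫ t in (0 : ℝ)..P.horizon, r t = P.N) (c : ℝ) :
    P.budgetAt c ≤ ∫ t in (0 : ℝ)..P.horizon,
      r t * P.outlay (max (P.sched (t + P.wait r t) - c) 0) := by
  have hH := P.horizon_pos.le
  set Φ : ℝ → ℝ := fun y => P.outlay (max (P.sched y - c) 0)
  have hΦ : Continuous Φ := P.continuous_outlay_sched c
  set Φ₀ := P.outlay (max (P.maxCost - c) 0)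
  set ψ : ℝ → ℝ := fun y => max (Φ₀ - Φ y) 0
  have hψ : Continuous ψ := by fun_prop
  have key := h.integral_arrival_le hψ (fun y => le_max_right _ _) (fun y hy => by
    rw [← sched_le_maxCost_iff, not_le] at hy
    exact max_eq_right (sub_nonpos.2 (P.outlay_max_mono (by linarith))))
  have h1 : ∫ y in (0 : ℝ)..P.horizon, ψ y =
      P.horizon * Φ₀ - ∫ y in (0 : ℝ)..P.horizon, Φ y := by
    have : ∫ y in (0 : ℝ)..P.horizon, ψ y = ∫ y in (0 : ℝ)..P.horizon, (Φ₀ - Φ y) := by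
      refine intervalIntegral.integral_congr fun y hy => ?_
      rw [uIcc_of_le hH, ← sched_le_maxCost_iff] at hy
      exact max_eq_left (sub_nonneg.2 (P.outlay_max_mono (by linarith)))
    rw [this, intervalIntegral.integral_sub (by simp) (hΦ.intervalIntegrable _ _)]
    simp
  have hi := h.intervalIntegrable_outlay c
  have h2 : P.N * Φ₀ - ∫ t in (0 : ℝ)..P.horizon, r t * Φ (t + P.wait r t) ≤
      ∫ t in (0 : ℝ)..P.horizon, r t * ψ (t + P.wait r t) := by
    rw [← hN, ← intervalIntegral.integral_mul_const,
      ← intervalIntegral.integral_sub (h.integrable.mul_const _) hi]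
    refine intervalIntegral.integral_mono_on hH ((h.integrable.mul_const _).sub hi) ?_ ?_
    · refine h.integrable.mul_continuousOn ?_
      rw [uIcc_of_le hH]
      exact hψ.comp_continuousOn (continuousOn_id.add h.continuousOn_wait)
    · intro t ht
      rw [← mul_sub]
      exact mul_le_mul_of_nonneg_left (le_max_left _ _) (h.nonneg t ht)
  rw [h1, mul_sub, ← mul_assoc, s_mul_horizon] at key
  rw [budgetAt]
  linarith

/-! ### Equilibria -/

lemma IsEquilibrium.isRate {p r δ : ℝ → ℝ} (h : P.IsEquilibrium p r δ) : P.IsRate r :=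
  ⟨h.rate_nonneg, h.rate_integrable⟩

/-- In equilibrium, the travel cost net of the perceived gain is equal to a constant `c` at all
times of departure, and at least `c` at all other times. -/
lemma IsEquilibrium.exists_cost {p r δ : ℝ → ℝ} (h : P.IsEquilibrium p r δ)
    (hp : ∀ t ∈ Icc 0 P.horizon, 0 ≤ p t) :
    ∃ c, (∀ t ∈ Icc 0 P.horizon, 0 < r t →
        P.travelCost r t = c + P.saving (p t) ∧ δ t = P.chargeTime (p t)) ∧
      ∀ t ∈ Icc 0 P.horizon, c + P.saving (p t) ≤ P.travelCost r t := by
  have hδ : ∀ t ∈ Icc 0 P.horizon, 0 < r t → δ t = P.chargeTime (p t) := by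
    intro t ht hrt
    have h1 := h.best_response t ht hrt t ht _ (P.chargeTime_mem (hp t ht))
    rw [cost, cost, chargeCost_chargeTime] at h1
    exact P.eq_chargeTime (hp t ht) (h.charge_mem t ht hrt).1 (by linarith)
  obtain ⟨t₀, ht₀, hr₀⟩ : ∃ t ∈ Icc 0 P.horizon, 0 < r t := by
    by_contra! h0
    have : ∫ t in (0 : ℝ)..P.horizon, r t = 0 := by
      rw [intervalIntegral.integral_congr (g := fun _ => 0)]
      · simp
      · intro t ht
        rw [uIcc_of_le P.horizon_pos.le] at ht
        exact le_antisymm (h0 t ht) (h.rate_nonneg t ht)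
    exact P.N_pos.ne (this.symm.trans h.rate_total)
  have hle : ∀ t ∈ Icc 0 P.horizon, 0 < r t → ∀ t' ∈ Icc 0 P.horizon,
      P.travelCost r t - P.saving (p t) ≤ P.travelCost r t' - P.saving (p t') := by
    intro t ht hrt t' ht'
    have h1 := h.best_response t ht hrt t' ht' _ (P.chargeTime_mem (hp t' ht'))
    rw [cost, cost, hδ t ht hrt, chargeCost_chargeTime, chargeCost_chargeTime] at h1
    linarith
  refine ⟨P.travelCost r t₀ - P.saving (p t₀), fun t ht hrt => ⟨?_, hδ t ht hrt⟩, fun t ht => ?_⟩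
  · have h1 := hle t ht hrt t₀ ht₀
    have h2 := hle t₀ ht₀ hr₀ t ht
    linarith
  · have := hle t₀ ht₀ hr₀ t ht
    linarith

/-- A discount worth `sched - level m` supports the closed-form departure rate. -/
lemma isEquilibrium_limitedRate {m : ℝ} (hm : m ∈ Icc 0 P.perceivedMax) {p : ℝ → ℝ}
    (hp : ∀ t ∈ Icc 0 P.horizon, 0 ≤ p t)
    (hs : ∀ t ∈ Icc 0 P.horizon, P.saving (p t) = max (P.sched t - P.level m) 0) :
    P.IsEquilibrium p (P.limitedRate m) fun t => P.chargeTime (p t) where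
  rate_nonneg t _ := (P.limitedRate_pos m t).le
  rate_integrable := P.limitedRate_intervalIntegrable m _ _
  rate_total := integral_limitedRate_horizon hm
  charge_mem t ht _ := P.chargeTime_mem (hp t ht)
  best_response t ht _ t' ht' δ' hδ' := by
    have h1 : ∀ t ∈ Icc 0 P.horizon,
        P.travelCost (P.limitedRate m) t = P.level m + P.saving (p t) := by
      intro t ht
      rw [travelCost_eq, wait_limitedRate hm ht, mul_add_sched_waitAt, hs t ht,
        ← max_add_add_left, add_zero, add_sub_cancel, max_comm]
    have h2 := P.chargeCost_ge (hp t' ht') hδ'.1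
    rw [cost, cost, h1 t ht, h1 t' ht', chargeCost_chargeTime]
    linarith

/-- A discount worth `sched - level m` admits no other waiting times in equilibrium. -/
lemma IsEquilibrium.wait_eq {m : ℝ} {p r δ : ℝ → ℝ}
    (h : P.IsEquilibrium p r δ) (hp : ∀ t ∈ Icc 0 P.horizon, 0 ≤ p t)
    (hs : ∀ t ∈ Icc 0 P.horizon, P.saving (p t) = max (P.sched t - P.level m) 0) :
    ∀ t ∈ Icc 0 P.horizon, P.wait r t = P.waitAt (P.level m) t := by
  have hR := h.isRate
  have hH := P.horizon_pos.le
  obtain ⟨c, hc, hle⟩ := h.exists_cost hp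
  have hlm := P.level_le m
  set l := P.level m
  have h0 : (0 : ℝ) ∈ Icc 0 P.horizon := ⟨le_rfl, hH⟩
  -- nobody waits at time `0`, which bounds the equilibrium cost
  have hcl : c ≤ l := by
    have h1 := hle 0 h0
    rw [travelCost_eq, wait_zero, hs 0 h0, mul_zero, add_zero, zero_add, sched_zero,
      max_eq_left (sub_nonneg.2 hlm)] at h1
    linarith
  -- a lower cost would make all commuters arrive in an interval that is too short
  have hlc : l ≤ c := by
    by_contra! hlt
    have hz : ∫ t in (0 : ℝ)..P.horizon,
        r t * P.outlay (max (P.sched (t + P.wait r t) - c) 0) = 0 := by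
      rw [intervalIntegral.integral_congr (g := fun _ => 0)]
      · simp
      intro t ht
      rw [uIcc_of_le hH] at ht
      rcases (h.rate_nonneg t ht).eq_or_lt with hrt | hrt
      · simp [← hrt]
      have hw := hR.wait_nonneg ht
      have h1 := (hc t ht hrt).1
      rw [travelCost_eq, hs t ht] at h1
      have h2 := (P.mul_add_sched_strictMono t).monotone hw
      simp only [mul_zero, add_zero, zero_add] at h2
      have h3 : P.sched t ≤ l := by
        by_contra! h4
        rw [max_eq_left (by linarith)] at h1
        linarith
      rw [max_eq_right (by linarith)] at h1
      have h4 := mul_nonneg P.α_pos.le hw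
      simp only
      rw [max_eq_right (by linarith), outlay_zero, mul_zero]
    have h1 := hR.budgetAt_le h.rate_total c
    have h2 := P.budgetAt_strictAntiOn (hcl.trans hlm) (mem_Iic.2 le_rfl) (hlt.trans_le hlm)
    rw [hz] at h1
    have h3 : P.budgetAt P.maxCost = 0 := by
      rw [← level_zero, ← P.f_eq P.zero_mem, f_zero]
    linarith
  obtain rfl : c = l := le_antisymm hcl hlc
  have hmax : ∀ t ∈ Icc 0 P.horizon, l + P.saving (p t) = max l (P.sched t) := by
    intro t ht
    rw [hs t ht, ← max_add_add_left, add_zero, add_sub_cancel, max_comm]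
  have hge : ∀ t ∈ Icc 0 P.horizon, P.waitAt l t ≤ P.wait r t := by
    intro t ht
    refine P.waitAt_le (hR.wait_nonneg ht) ?_
    have := hle t ht
    rw [travelCost_eq, hmax t ht] at this
    exact (le_max_left _ _).trans this
  have heq : ∀ t ∈ Icc 0 P.horizon, 0 < r t → P.wait r t = P.waitAt l t := by
    intro t ht hrt
    have := (hc t ht hrt).1
    rw [travelCost_eq, hmax t ht] at this
    exact P.eq_waitAt this
  intro t ht
  by_contra hne
  -- `u` is the last time before `t` at which the waiting times agree; then nobody departs
  have hcont : ContinuousOn (fun v => P.wait r v - P.waitAt l v) (Icc 0 t) :=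
    (hR.continuousOn_wait.mono (Icc_subset_Icc_right ht.2)).sub
      (P.continuous_waitAt l).continuousOn
  set A := Icc 0 t ∩ (fun v => P.wait r v - P.waitAt l v) ⁻¹' {0}
  have hA : IsCompact A := isCompact_Icc.of_isClosed_subset
    (hcont.preimage_isClosed_of_isClosed isClosed_Icc isClosed_singleton) inter_subset_left
  have hA0 : (0 : ℝ) ∈ A := by
    refine ⟨⟨le_rfl, ht.1⟩, ?_⟩
    have : P.waitAt l 0 = 0 := P.waitAt_eq_zero (hlm.trans_eq P.sched_zero.symm)
    simp [wait_zero, this]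
  obtain ⟨u, hu, hug⟩ := hA.exists_isGreatest ⟨0, hA0⟩
  have hut := hu.1.2
  have huw : P.wait r u = P.waitAt l u := sub_eq_zero.1 hu.2
  have hr0 : ∀ v ∈ Ioc u t, r v = 0 := by
    intro v hv
    have hvH : v ∈ Icc 0 P.horizon := ⟨hu.1.1.trans hv.1.le, hv.2.trans ht.2⟩
    by_contra hrv
    have := heq v hvH (lt_of_le_of_ne (h.rate_nonneg v hvH) (Ne.symm hrv))
    exact hv.1.not_ge (hug ⟨⟨hvH.1, hv.2⟩, sub_eq_zero.2 this⟩)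
  have hlt : P.waitAt l t < P.wait r t := lt_of_le_of_ne (hge t ht) (Ne.symm hne)
  have hq := hR.queue_le_of_rate_eq_zero hu.1.1 hut ht.2 hr0
  have hpos : 0 < P.wait r t := (P.waitAt_nonneg l t).trans_lt hlt
  have hqpos : 0 < P.queue r t := by
    rw [← s_mul_wait]; exact mul_pos P.s_pos hpos
  rcases le_max_iff.1 hq with h1 | h1
  · linarith
  · rw [← s_mul_wait, ← s_mul_wait, ← mul_sub, mul_le_mul_iff_right₀ P.s_pos, huw] at h1
    have := (P.add_waitAt_strictMono l).monotone hut
    linarith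

/-! ### Optimality -/

lemma limitedRate_mul {m : ℝ} (hm : m ∈ Icc 0 P.perceivedMax) (t : ℝ) {G : ℝ → ℝ} (hG : G 0 = 0) :
    P.limitedRate m t * G (max (P.sched t - P.level m) 0) =
      P.s * G (max (P.sched t - P.level m) 0) := by
  rcases le_or_gt (P.sched t) (P.level m) with h | h
  · rw [max_eq_right (sub_nonpos.2 h), hG, mul_zero, mul_zero]
  · have h' := h.not_ge
    rw [sched_le_level_iff] at h'
    rw [limitedRate, if_neg, if_neg]
    · exact fun ht => h' ⟨(P.tLeft_le_tPeak hm).trans ht.1.le, ht.2.le⟩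
    · exact fun ht => h' ⟨ht.1.le, ht.2.trans (P.tPeak_le_tRight hm)⟩

/-- The closed form spends `f m`, of which commuters perceive `m`. -/
lemma isFeasible_limitedDiscount {m : ℝ} (hm : m ∈ Icc 0 P.perceivedMax) :
    P.IsFeasible (P.f m) (P.limitedDiscount m) (P.limitedRate m)
        (fun t => P.chargeTime (P.limitedDiscount m t)) ∧
      P.spent (P.limitedDiscount m) (P.limitedRate m)
        (fun t => P.chargeTime (P.limitedDiscount m t)) = P.f m ∧
      P.perceived (P.limitedDiscount m) (P.limitedRate m)
        (fun t => P.chargeTime (P.limitedDiscount m t)) = m := by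
  have hd := P.limitedDiscount_isDiscount hm
  have heq : ∀ t ∈ Icc 0 P.horizon, P.limitedRate m t *
      P.chargeTime (P.limitedDiscount m t) * P.limitedDiscount m t =
      P.s * P.outlay (max (P.sched t - P.level m) 0) := by
    intro t ht
    rw [mul_assoc, P.chargeTime_mul (hd.2 t ht), ← outlay_saving, P.saving_limitedDiscount hm,
      limitedRate_mul hm t P.outlay_zero]
  have hspent : P.spent (P.limitedDiscount m) (P.limitedRate m)
      (fun t => P.chargeTime (P.limitedDiscount m t)) = P.f m := by
    rw [P.f_eq hm, budgetAt, ← intervalIntegral.integral_const_mul]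
    refine intervalIntegral.integral_congr fun t ht => heq t ?_
    rwa [uIcc_of_le P.horizon_pos.le] at ht
  refine ⟨⟨hd, isEquilibrium_limitedRate hm hd.2 fun t _ => P.saving_limitedDiscount hm t, ?_,
    hspent.le⟩, hspent, ?_⟩
  · refine IntervalIntegrable.congr (f := fun t =>
      P.s * P.outlay (max (P.sched t - P.level m) 0)) (fun t ht => ?_)
      ((continuous_const.mul (P.continuous_outlay_sched _)).intervalIntegrable _ _)
    rw [uIoc_of_le P.horizon_pos.le] at ht
    exact (heq t (Ioc_subset_Icc_self ht)).symm
  · nth_rw 4 [← P.integral_gain hm]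
    rw [perceived, ← intervalIntegral.integral_neg, ← intervalIntegral.integral_const_mul]
    congr 1
    ext t
    rw [chargeCost_chargeTime, P.saving_limitedDiscount hm,
      ← limitedRate_mul hm t (G := fun v => v) rfl]
    ring

/-- A budget of `f m` cannot lower the equilibrium cost below `level m`, and an equilibrium cost
`c` requires waiting times of at least `waitAt c`. -/
lemma IsFeasible.exists_cost {m : ℝ} (hm : m ∈ Icc 0 P.perceivedMax) {p r δ : ℝ → ℝ}
    (h : P.IsFeasible (P.f m) p r δ) :
    ∃ c, P.level m ≤ c ∧ P.budgetAt c ≤ P.spent p r δ ∧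
      (∀ t ∈ Icc 0 P.horizon, P.waitAt (P.level m) t ≤ P.wait r t) ∧
      (∀ t ∈ Icc 0 P.horizon, 0 < r t → P.travelCost r t = c + P.saving (p t)) ∧
      ∀ t ∈ Icc 0 P.horizon, c ≤ P.travelCost r t := by
  have hp := h.discount.2
  have hR := h.equilibrium.isRate
  obtain ⟨c, hc, hle⟩ := h.equilibrium.exists_cost hp
  have hle' : ∀ t ∈ Icc 0 P.horizon, c ≤ P.travelCost r t := fun t ht =>
    (le_add_of_nonneg_right (P.saving_nonneg (hp t ht))).trans (hle t ht)
  have hspent : P.budgetAt c ≤ P.spent p r δ := by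
    refine (hR.budgetAt_le h.equilibrium.rate_total c).trans ?_
    refine intervalIntegral.integral_mono_on P.horizon_pos.le (hR.intervalIntegrable_outlay c)
      h.integrable fun t ht => ?_
    rcases (hR.nonneg t ht).eq_or_lt with hrt | hrt
    · simp [← hrt]
    obtain ⟨h1, h2⟩ := hc t ht hrt
    rw [mul_assoc, h2, P.chargeTime_mul (hp t ht), ← outlay_saving]
    refine mul_le_mul_of_nonneg_left ?_ hrt.le
    have hsv := P.saving_nonneg (hp t ht)
    rw [← max_eq_left hsv]
    refine P.outlay_max_mono ?_
    rw [travelCost_eq] at h1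
    have := mul_nonneg P.α_pos.le (hR.wait_nonneg ht)
    linarith
  have hlc : P.level m ≤ c := by
    by_contra! hlt
    have h1 := P.budgetAt_strictAntiOn (hlt.le.trans (P.level_le m)) (P.level_le m) hlt
    rw [← P.f_eq hm] at h1
    linarith [h.spent_le]
  refine ⟨c, hlc, hspent, fun t ht => ?_, fun t ht hrt => (hc t ht hrt).1, hle'⟩
  refine P.waitAt_le (hR.wait_nonneg ht) ?_
  rw [← travelCost_eq]
  exact hlc.trans (hle' t ht)

lemma tstt_limitedRate {m : ℝ} (hm : m ∈ Icc 0 P.perceivedMax) :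
    P.tstt (P.limitedRate m) = ∫ t in (0 : ℝ)..P.horizon, P.waitAt (P.level m) t :=
  intervalIntegral.integral_congr fun t ht => by
    rw [uIcc_of_le P.horizon_pos.le] at ht
    exact wait_limitedRate hm ht

lemma IsFeasible.tstt_le {m : ℝ} (hm : m ∈ Icc 0 P.perceivedMax) {p r δ : ℝ → ℝ}
    (h : P.IsFeasible (P.f m) p r δ) : P.tstt (P.limitedRate m) ≤ P.tstt r := by
  obtain ⟨c, -, -, hw, -⟩ := h.exists_cost hm
  rw [tstt_limitedRate hm]
  exact intervalIntegral.integral_mono_on P.horizon_pos.le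
    ((P.continuous_waitAt _).intervalIntegrable _ _)
    (h.equilibrium.isRate.continuousOn_wait.intervalIntegrable_of_Icc P.horizon_pos.le) hw

lemma IsFeasible.wait_eq {m : ℝ} (hm : m ∈ Icc 0 P.perceivedMax) {p r δ : ℝ → ℝ}
    (h : P.IsFeasible (P.f m) p r δ) (hle : P.tstt r ≤ P.tstt (P.limitedRate m)) :
    ∀ t ∈ Icc 0 P.horizon, P.wait r t = P.waitAt (P.level m) t := by
  obtain ⟨c, -, -, hw, -⟩ := h.exists_cost hm
  intro t ht
  by_contra hne
  refine hle.not_gt ?_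
  rw [tstt_limitedRate hm]
  exact intervalIntegral.integral_lt_integral_of_continuousOn_of_le_of_exists_lt P.horizon_pos
    (P.continuous_waitAt _).continuousOn h.equilibrium.isRate.continuousOn_wait
    (fun x hx => hw x (Ioc_subset_Icc_self hx))
    ⟨t, ht, lt_of_le_of_ne (hw t ht) (Ne.symm hne)⟩

lemma travelCost_eq_max {c t : ℝ} {r : ℝ → ℝ} (h : P.wait r t = P.waitAt c t) :
    P.travelCost r t = max c (P.sched t) := by
  rw [travelCost_eq, h, mul_add_sched_waitAt]

/-- A feasible policy of minimal congestion has equilibrium cost `level m`, which determines its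
discount at the times of departure. -/
lemma IsFeasible.eq_of_tstt_le {m : ℝ} (hm : m ∈ Icc 0 P.perceivedMax) {p r δ : ℝ → ℝ}
    (h : P.IsFeasible (P.f m) p r δ) (hle : P.tstt r ≤ P.tstt (P.limitedRate m)) :
    P.f m ≤ P.spent p r δ ∧ ∀ t ∈ Icc 0 P.horizon, 0 < r t →
      P.saving (p t) = max (P.sched t - P.level m) 0 := by
  obtain ⟨c, hlc, hspent, -, hc, hle'⟩ := h.exists_cost hm
  have hw := h.wait_eq hm hle
  have hcl : c ≤ P.level m := by
    have ht : P.tStar ∈ Icc 0 P.horizon := ⟨P.tStar_pos.le, P.tStar_lt_horizon.le⟩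
    have h1 := hle' _ ht
    rwa [travelCost_eq_max (hw _ ht), sched_tStar, max_eq_left (P.level_nonneg hm)] at h1
  obtain rfl : P.level m = c := le_antisymm hlc hcl
  refine ⟨(P.f_eq hm).trans_le hspent, fun t ht hrt => ?_⟩
  have h1 := hc t ht hrt
  rw [travelCost_eq_max (hw t ht)] at h1
  rw [eq_sub_of_add_eq' h1.symm, max_comm, ← max_sub_sub_right, sub_self]

lemma isOptimal_limitedDiscount {m : ℝ} (hm : m ∈ Icc 0 P.perceivedMax) :
    P.IsOptimal (P.f m) (P.limitedDiscount m) (P.limitedRate m)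
      (fun t => P.chargeTime (P.limitedDiscount m t)) where
  feasible := (isFeasible_limitedDiscount hm).1
  tstt_le _ _ _ h := h.tstt_le hm
  spent_le _ _ _ h heq := (isFeasible_limitedDiscount hm).2.1.trans_le
    (h.eq_of_tstt_le hm heq.le).1

/-- Optimal discounts agree with the closed form wherever that is positive, and are too small to
have an effect elsewhere. -/
lemma IsOptimal.ae_eq {m : ℝ} (hm : m ∈ Icc 0 P.perceivedMax) {p r δ : ℝ → ℝ}
    (h : P.IsOptimal (P.f m) p r δ) : ∀ᵐ t, t ∈ Icc 0 P.horizon →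
      (p t = P.limitedDiscount m t ∨ t ∈ Ioo (P.tLeft m) (P.tRight m) ∧ p t ≤ P.α) ∧
        r t = P.limitedRate m t := by
  have hle := h.tstt_le _ _ _ (isFeasible_limitedDiscount hm).1
  have hF := h.feasible
  filter_upwards [hF.equilibrium.isRate.ae_eq_limitedRate hF.equilibrium.rate_total hm
      (hF.wait_eq hm hle), compl_mem_ae_iff.2 (measure_singleton (P.tLeft m)),
    compl_mem_ae_iff.2 (measure_singleton (P.tRight m))] with t hrt htl htr ht
  have hr := hrt ht
  refine ⟨?_, hr⟩
  have hs := (hF.eq_of_tstt_le hm hle).2 t ht (hr ▸ P.limitedRate_pos m t)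
  rcases le_or_gt (P.sched t) (P.level m) with hst | hst
  · have h1 := P.sched_le_level_iff.1 hst
    rw [max_eq_right (sub_nonpos.2 hst)] at hs
    exact Or.inr ⟨⟨lt_of_le_of_ne h1.1 (Ne.symm htl), lt_of_le_of_ne h1.2 htr⟩,
      P.le_of_saving_eq_zero hs⟩
  · left
    have hpos : 0 < max (P.sched t - P.level m) 0 := lt_max_of_lt_left (sub_pos.2 hst)
    rw [P.eq_priceOf hpos hs, P.limitedDiscount_of_notMem _ hm]
    exact fun h => hst.not_ge (P.sched_le_level_iff.2 ⟨h.1.le, h.2.le⟩)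

lemma saving_zero_eq : ∀ t ∈ Icc 0 P.horizon,
    P.saving 0 = max (P.sched t - P.level 0) 0 := by
  intro t ht
  rw [P.saving_of_le P.α_pos.le, level_zero, max_eq_right]
  exact sub_nonpos.2 (P.sched_le_maxCost_iff.2 ht)

end Bottleneck

end

open Bottleneck

theorem proposition2 (P : Bottleneck) :
    -- the relation between perceived and monetary budgets can be inverted
    Set.BijOn P.f (Set.Icc 0 P.perceivedMax) (Set.Icc 0 P.budgetMax) ∧
    -- without incentive, `tPrime` is the departure time for which one arrives at `tStar`
    (∃ r₀ δ₀ : ℝ → ℝ, P.IsEquilibrium (fun _ => 0) r₀ δ₀) ∧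
    (∀ r₀ δ₀ : ℝ → ℝ, P.IsEquilibrium (fun _ => 0) r₀ δ₀ →
      ∀ t ∈ Set.Icc 0 P.horizon, t + P.wait r₀ t = P.tStar ↔ t = P.tPrime) ∧
    ∀ M : ℝ, 0 ≤ M → M ≤ P.budgetMax →
      -- the closed form is optimal, with the stated departure rate, and uses the whole budget
      (∃ δ : ℝ → ℝ,
        P.IsOptimal M (P.limitedDiscount (P.fInv M)) (P.limitedRate (P.fInv M)) δ ∧
        P.spent (P.limitedDiscount (P.fInv M)) (P.limitedRate (P.fInv M)) δ = M ∧
        P.perceived (P.limitedDiscount (P.fInv M)) (P.limitedRate (P.fInv M)) δ = P.fInv M) ∧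
      -- `tPeak` is the departure time for which one arrives at `tStar`
      (∀ t ∈ Set.Icc 0 P.horizon,
        t + P.wait (P.limitedRate (P.fInv M)) t = P.tStar ↔ t = P.tPeak (P.fInv M)) ∧
      -- it is the only equilibrium departure rate under this discount
      (∀ r δ : ℝ → ℝ, P.IsEquilibrium (P.limitedDiscount (P.fInv M)) r δ →
        ∀ᵐ t, t ∈ Set.Icc 0 P.horizon → r t = P.limitedRate (P.fInv M) t) ∧
      -- the optimal discount is unique, except that inside the interval every discount of at most
      -- `α` is as ineffective as a zero discount
      (∀ p r δ : ℝ → ℝ, P.IsOptimal M p r δ →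
        ∀ᵐ t, t ∈ Set.Icc 0 P.horizon →
          (p t = P.limitedDiscount (P.fInv M) t ∨
            t ∈ Set.Ioo (P.tLeft (P.fInv M)) (P.tRight (P.fInv M)) ∧ p t ≤ P.α) ∧
          r t = P.limitedRate (P.fInv M) t) := by
  refine ⟨P.f_bijOn, ⟨_, _, isEquilibrium_limitedRate P.zero_mem (fun _ _ => le_rfl)
    (p := fun _ => 0) saving_zero_eq⟩, fun r₀ δ₀ h t ht => ?_, fun M hM0 hM => ?_⟩
  · rw [h.wait_eq (fun _ _ => le_rfl) saving_zero_eq t ht, level_zero,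
      P.add_waitAt_eq_tStar_iff P.maxCost_pos.le, tPrime_eq]
  have hm := P.fInv_mem ⟨hM0, hM⟩
  have hf := P.f_fInv ⟨hM0, hM⟩
  set m := P.fInv M
  rw [← hf]
  refine ⟨⟨_, isOptimal_limitedDiscount hm, (isFeasible_limitedDiscount hm).2⟩,
    fun t ht => ?_, fun r δ h => ?_, fun p r δ h => h.ae_eq hm⟩
  · rw [wait_limitedRate hm ht, P.add_waitAt_eq_tStar_iff (P.level_nonneg hm), tPeak_eq]
  · exact h.isRate.ae_eq_limitedRate h.rate_total hm
      (h.wait_eq (P.limitedDiscount_isDiscount hm).2 fun t _ => P.saving_limitedDiscount hm t)
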